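/- For $0<p\le\infty$ and $q\ge 0$ define $M_{p,q}$ on $[0,\infty)\times[0,\infty)$ by $M_{p,q}(s,t)=(s^p+t^p)^{q/p}$ if $p<\infty$ and $M_{\infty,q}(s,t)=\max\{s,t\}^q$ (with $0^0=1$). The $(p,q)$-relative distance in $\mathbb R^n$ is $$\rho_{p,q}(x,y)=\frac{|x-y|}{M_{p,q}(|x|,|y|)},\qquad 0/0:=0,$$ where $|\cdot|$ is the Euclidean norm; it is called the $(p,q)$-relative metric when it is a metric in $\mathbb R^n$, which is assumed below. The length of a path $\gamma\colon[0,l]\to\mathbb R^n$, continuous with respect to a metric $d$ on $\mathbb R^n$, is the limit of $\sum_i d(\gamma(t_i),\gamma(t_{i+1}))$ over partitions $0=t_0<t_1<\dots<t_k=l$ as $\max_i(t_{i+1}-t_i)\to0$; $\gamma$ is rectifiable if this limit exists and is finite. The metric $d$ is $c$-quasiconvex if, for all $x,y$, the infimum of the lengths of the rectifiable paths joining $x$ and $y$ (which is $\infty$ if there are none) is at most $c\,d(x,y)$, and quasiconvex if it is $c$-quasiconvex for some $c<\infty$. It is locally convex if for every $x$ there is $r_0>0$ such that the ball $\{y: d(x,y)<r\}$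 is a convex subset of $\mathbb R^n$ for every $0<r<r_0$. **Theorem 1.2.** Let $0<p\le\infty$ and $q\ge0$, and use the convention $1/\infty=0$. (1) If $n\ge2$, the $(p,q)$-relative metric in $\mathbb R^n$ is quasiconvex if and only if $q<1$. If $q<1$, there is a smallest constant $c_{p,q}$ for which it is $c_{p,q}$-quasiconvex; this constant does not depend on $n\ge2$, and $$\frac{2^{-q/p}}{1-q}\le c_{p,q}\le\frac{\max\{2^{q(1-1/p)},1\}}{1-q}.$$ (2) If $n\ge2$ and $q>0$, the $(p,q)$-relative metric in $\mathbb R^n$ is locally convex if and only if $p<\infty$. If $p<\infty$, it is locally convex also for $n=1$ and for $q=0$. -/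

import Mathlib

open scoped ENNReal

/-- `d` is a metric on `X`. -/
structure IsMetric {X : Type*} (d : X → X → ℝ) : Prop where
  nonneg : ∀ x y, 0 ≤ d x y
  eq_zero_iff : ∀ x y, d x y = 0 ↔ x = y
  symm : ∀ x y, d x y = d y x
  triangle : ∀ x y z, d x z ≤ d x y + d y z

/-- `M(s,t) = (s^p + t^p)^(q/p)` for `0 < p < ∞`, and `M(s,t) = max(s,t)^q` for `p = ∞`
(used for `s, t ≥ 0`). -/
noncomputable def pqM (p : ℝ≥0∞) (q s t : ℝ) : ℝ :=
  if p = ⊤ then (max s t) ^ q else (s ^ p.toReal + t ^ p.toReal) ^ (q / p.toReal)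

/-- The `M`-relative distance `‖x - y‖ / M(‖x‖, ‖y‖)`, with `0 / 0 = 0`.
For `M = pqM p q` the denominator vanishes at most for `x = y = 0`. -/
noncomputable def relDist {E : Type*} [NormedAddCommGroup E] (M : ℝ → ℝ → ℝ) (x y : E) : ℝ :=
  ‖x - y‖ / M ‖x‖ ‖y‖

/-- The `(p,q)`-relative distance in `ℝⁿ`. -/
noncomputable def pqDist (p : ℝ≥0∞) (q : ℝ) (n : ℕ) (x y : EuclideanSpace ℝ (Fin n)) : ℝ :=
  relDist (pqM p q) x y

/-- `γ` restricted to `[0,l]` is a path joining `x` to `y` that is continuous in the metric `d`. -/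
structure IsPathJoining {X : Type*} (d : X → X → ℝ) (γ : ℝ → X) (l : ℝ) (x y : X) : Prop where
  nonneg : 0 ≤ l
  source : γ 0 = x
  target : γ l = y
  cont : ∀ t ∈ Set.Icc 0 l, ∀ ε > 0, ∃ δ > 0, ∀ s ∈ Set.Icc 0 l, |s - t| < δ → d (γ s) (γ t) < ε

/-- `γ : [0,l] → X` is rectifiable of length `L`: the sums `∑ d(γ(tᵢ), γ(tᵢ₊₁))` over
partitions `0 = t₀ < ⋯ < tₖ = l` converge to the real number `L` as the mesh tends to `0`. -/
def HasLength {X : Type*} (d : X → X → ℝ) (γ : ℝ → X) (l L : ℝ) : Prop :=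
  ∀ ε > 0, ∃ δ > 0, ∀ (k : ℕ) (t : ℕ → ℝ), t 0 = 0 → t k = l →
    (∀ i < k, t i < t (i + 1)) → (∀ i < k, t (i + 1) - t i < δ) →
    |∑ i ∈ Finset.range k, d (γ (t i)) (γ (t (i + 1))) - L| < ε

/-- The infimum of the lengths of the rectifiable paths joining `x` to `y`
(`∞` if there are none). -/
noncomputable def innerDist {X : Type*} (d : X → X → ℝ) (x y : X) : ℝ≥0∞ :=
  sInf {a | ∃ (γ : ℝ → X) (l L : ℝ),
    IsPathJoining d γ l x y ∧ HasLength d γ l L ∧ a = ENNReal.ofReal L}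

/-- `d` is `c`-quasiconvex. -/
def IsQuasiconvexWith {X : Type*} (d : X → X → ℝ) (c : ℝ) : Prop :=
  ∀ x y, innerDist d x y ≤ ENNReal.ofReal (c * d x y)

/-- `d` is quasiconvex, i.e. `c`-quasiconvex for some finite `c`. -/
def IsQuasiconvex {X : Type*} (d : X → X → ℝ) : Prop :=
  ∃ c : ℝ, IsQuasiconvexWith d c

/-- `d` is locally convex: around every point, all sufficiently small open `d`-balls are convex
subsets of the ambient vector space. -/
def IsLocallyConvex {E : Type*} [AddCommGroup E] [Module ℝ E] (d : E → E → ℝ) : Prop :=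
  ∀ x, ∃ r₀ > 0, ∀ r, 0 < r → r < r₀ → Convex ℝ {y | d x y < r}

/-!
Write `P = q / p` (with `1 / ∞ = 0`). The weight `M = pqM p q` satisfies
`2 ^ P * min s t ^ q ≤ M s t ≤ 2 ^ P * max s t ^ q`, so lengths in the relative metric are given by
the density `2 ^ (-P) * ‖z‖ ^ (-q)`. A relative metric has `q ≤ 1` (`le_one_of_isMetric`).

*Quasiconvexity.* For `q = 1` the origin has distance `1` from all other points, hence is isolated
(`innerDist_zero_eq_top_of_eq_one`). For `q < 1` the inner distance from the origin to `x` is at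
least `2 ^ (-P) * ‖x‖ ^ (1 - q) / (1 - q)` (`le_innerDist_zero`), while the distance is
`‖x‖ ^ (1 - q)`; this is the lower bound for the constant. For the upper bound it is enough to
consider segments. Since `‖(1 - τ) • x + τ • y‖ ≥ |τ * ‖y‖ - (1 - τ) * ‖x‖|`, the segment from `x`
to `y` is at most as long, relative to `‖x - y‖`, as a segment through the origin whose endpoints
have the same norms. The length of the latter is explicit once chords on the line are known to be
bounded by the integral of the density (`relDist_le_signedRpow`), and this is where the triangle
inequality enters. Concavity of `u ↦ u ^ (1 - q)` and the comparison of the power mean `M` with the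
arithmetic mean finish the estimate (`isQuasiconvexWith_relDist`).

The set of admissible constants is closed and does not depend on the dimension: folding the space
around a line onto a half plane keeps norms and does not increase distances, so it shortens paths
(`IsQuasiconvexWith.of_finrank`). That shortened paths are again rectifiable requires that the
limit in the definition of length is a supremum (`IsPathJoining.exists_hasLength`).

*Local convexity.* For `p < ∞` and `x ≠ 0` the ball of radius `r` is the set where
`‖x - y‖ ^ 2 - r ^ 2 * m ‖y‖ ^ 2 = ‖x‖ ^ 2 - 2 * ⟪x, y⟫ + k ‖y‖` is negative, with `m` smooth near
`‖x‖` and `k τ = τ ^ 2 - r ^ 2 * m τ ^ 2`. For small `r` the function `k` is convex and monotone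
near `‖x‖`, which makes the left side convex in `y` (`exists_convex_setOf_norm_sub_lt`). Around the
origin balls are Euclidean balls or, for `q = 1`, points. For `p = ∞` the weight `max 1 ‖y‖ ^ q` has
a convex kink along the unit sphere, which makes a reentrant corner in the boundary of each small
ball around a unit vector (`not_isLocallyConvex_relDist_top`).
-/

/-! ### Lengths of paths in an abstract metric -/

/-- `t 0 < t 1 < ⋯ < t k` is a partition of `[0, l]`; the values `t i` for `i > k` are irrelevant. -/
structure IsPartition (l : ℝ) (k : ℕ) (t : ℕ → ℝ) : Prop where
  zero : t 0 = 0
  last : t k = l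
  lt : ∀ i < k, t i < t (i + 1)

lemma IsPartition.mono {l : ℝ} {k : ℕ} {t : ℕ → ℝ} (h : IsPartition l k t) {i j : ℕ}
    (hij : i ≤ j) (hj : j ≤ k) : t i ≤ t j := by
  induction j, hij using Nat.le_induction with
  | base => exact le_rfl
  | succ j _ ih => exact (ih (by omega)).trans (h.lt j (by omega)).le

lemma IsPartition.mem_Icc {l : ℝ} {k : ℕ} {t : ℕ → ℝ} (h : IsPartition l k t) {i : ℕ}
    (hi : i ≤ k) : t i ∈ Set.Icc 0 l :=
  ⟨h.zero ▸ h.mono (Nat.zero_le i) hi, h.last ▸ h.mono hi le_rfl⟩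

lemma exists_isPartition {l δ : ℝ} (hl : 0 ≤ l) (hδ : 0 < δ) :
    ∃ (k : ℕ) (t : ℕ → ℝ), IsPartition l k t ∧ ∀ i < k, t (i + 1) - t i < δ := by
  rcases hl.eq_or_lt with rfl | hl
  · exact ⟨0, fun _ => 0, ⟨rfl, rfl, by simp⟩, by simp⟩
  obtain ⟨k, hk⟩ := exists_nat_gt (l / δ)
  have hk0 : (0 : ℝ) < k := (div_pos hl hδ).trans hk
  have hstep : ∀ i : ℕ, ((i + 1 : ℕ) : ℝ) * (l / k) - i * (l / k) = l / k := by
    intro i; push_cast; ring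
  refine ⟨k, fun i => i * (l / k), ⟨by simp, by field_simp, fun i _ => ?_⟩, fun i _ => ?_⟩
  · have := hstep i
    have := div_pos hl hk0
    linarith
  · rw [hstep, div_lt_iff₀ hk0]
    rwa [div_lt_iff₀ hδ, mul_comm] at hk

section Paths

variable {X Y : Type*} {d : X → X → ℝ} {γ : ℝ → X} {l : ℝ} {x y : X}

lemma IsMetric.self_eq_zero (hd : IsMetric d) (x : X) : d x x = 0 := (hd.eq_zero_iff x x).2 rfl

lemma IsMetric.le_sum_Ico (hd : IsMetric d) (z : ℕ → X) {a b : ℕ} (hab : a ≤ b) :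
    d (z a) (z b) ≤ ∑ i ∈ Finset.Ico a b, d (z i) (z (i + 1)) := by
  induction b, hab using Nat.le_induction with
  | base => simp [hd.self_eq_zero]
  | succ b hb ih =>
    rw [Finset.sum_Ico_succ_top hb]
    exact (hd.triangle _ (z b) _).trans (by gcongr)

/-- Heine–Cantor for a path that is continuous in the metric `d`. -/
lemma IsPathJoining.uniform (hd : IsMetric d) (hγ : IsPathJoining d γ l x y) {ε : ℝ}
    (hε : 0 < ε) :
    ∃ δ > 0, ∀ s ∈ Set.Icc 0 l, ∀ t ∈ Set.Icc 0 l, |s - t| < δ → d (γ s) (γ t) < ε := by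
  let _ : PseudoMetricSpace X :=
    { dist := d
      dist_self := hd.self_eq_zero
      dist_comm := hd.symm
      dist_triangle := hd.triangle }
  have hc : ContinuousOn γ (Set.Icc 0 l) := by
    rw [Metric.continuousOn_iff]
    exact hγ.cont
  have hu := isCompact_Icc.uniformContinuousOn_of_continuous hc
  rw [Metric.uniformContinuousOn_iff] at hu
  exact hu ε hε

lemma IsPathJoining.continuousOn_dist (hd : IsMetric d) (hγ : IsPathJoining d γ l x y) (z : X) :
    ContinuousOn (fun t => d (γ t) z) (Set.Icc 0 l) := by
  rw [Metric.continuousOn_iff]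
  intro t ht ε hε
  obtain ⟨δ, hδ, h⟩ := hγ.cont t ht ε hε
  refine ⟨δ, hδ, fun s hs hst => ?_⟩
  have h0 := h s hs hst
  rw [Real.dist_eq, abs_lt]
  have h1 := hd.triangle (γ s) (γ t) z
  have h2 := hd.triangle (γ t) (γ s) z
  rw [hd.symm (γ t) (γ s)] at h2
  constructor <;> linarith

/-- If `d (γ a) (γ b) ≤ η` for `|a - b| < δ`, then every sum along a partition with `m` intervals
exceeds the sum along a partition of mesh less than `δ` by at most `2 m η`: each point of the
former is replaced by the nearest point of the latter to its left. -/
lemma IsPartition.sum_le_sum_add (hd : IsMetric d) {δ η : ℝ} (hδ : 0 < δ)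
    (hη : ∀ a ∈ Set.Icc 0 l, ∀ b ∈ Set.Icc 0 l, |a - b| < δ → d (γ a) (γ b) ≤ η)
    {k m : ℕ} {t s : ℕ → ℝ} (ht : IsPartition l k t) (hmesh : ∀ i < k, t (i + 1) - t i < δ)
    (hs : IsPartition l m s) :
    ∑ j ∈ Finset.range m, d (γ (s j)) (γ (s (j + 1))) ≤
      ∑ i ∈ Finset.range k, d (γ (t i)) (γ (t (i + 1))) + 2 * m * η := by
  classical
  set N : ℝ → ℕ := fun τ => Nat.findGreatest (fun i => t i ≤ τ) k with hN
  have hNk : ∀ τ, N τ ≤ k := fun τ => Nat.findGreatest_le k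
  have hNle : ∀ τ ∈ Set.Icc 0 l, t (N τ) ≤ τ := fun τ hτ =>
    Nat.findGreatest_spec (P := fun i => t i ≤ τ) (Nat.zero_le k) (by simpa [ht.zero] using hτ.1)
  have hNmono : ∀ τ ∈ Set.Icc 0 l, ∀ τ', τ ≤ τ' → N τ ≤ N τ' := fun τ hτ τ' h =>
    Nat.le_findGreatest (hNk τ) ((hNle τ hτ).trans h)
  have hNclose : ∀ τ ∈ Set.Icc 0 l, |τ - t (N τ)| < δ := by
    intro τ hτ
    rw [abs_of_nonneg (sub_nonneg.2 (hNle τ hτ))]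
    rcases (hNk τ).eq_or_lt with h | h
    · rw [h, ht.last]
      linarith [hτ.2]
    · have h1 : ¬ t (N τ + 1) ≤ τ :=
        Nat.findGreatest_is_greatest (P := fun i => t i ≤ τ) (Nat.lt_succ_self _) h
      linarith [hmesh _ h]
  have key : ∀ j ≤ m, ∑ j ∈ Finset.range j, d (γ (s j)) (γ (s (j + 1))) ≤
      ∑ i ∈ Finset.range (N (s j)), d (γ (t i)) (γ (t (i + 1))) + 2 * j * η := by
    intro j
    induction j with
    | zero =>
      intro _
      have := Finset.sum_nonneg (s := Finset.range (N (s 0)))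
        (fun i _ => hd.nonneg (γ (t i)) (γ (t (i + 1))))
      simpa using this
    | succ j ih =>
      intro hj
      have hm0 := hs.mem_Icc (Nat.le_of_succ_le hj)
      have hm1 := hs.mem_Icc hj
      have hle := hNmono _ hm0 _ (hs.lt j hj).le
      have h1 := hη _ hm0 _ (ht.mem_Icc (hNk (s j))) (hNclose _ hm0)
      have h2 := hη _ hm1 _ (ht.mem_Icc (hNk (s (j + 1)))) (hNclose _ hm1)
      rw [hd.symm] at h2
      have h3 := hd.le_sum_Ico (fun i => γ (t i)) hle
      have h4 := hd.triangle (γ (s j)) (γ (t (N (s j)))) (γ (s (j + 1)))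
      have h5 := hd.triangle (γ (t (N (s j)))) (γ (t (N (s (j + 1))))) (γ (s (j + 1)))
      rw [Finset.sum_range_succ, ← Finset.sum_range_add_sum_Ico _ hle]
      push_cast
      have := ih (Nat.le_of_succ_le hj)
      linarith
  refine (key m le_rfl).trans ?_
  gcongr
  · exact fun i _ _ => hd.nonneg _ _
  · exact hNk _

/-- A uniform continuity scale `δ` at which the partition of `m` intervals loses at most `ε`
against every partition of mesh less than `δ`. -/
lemma IsPathJoining.exists_mesh (hd : IsMetric d) (hγ : IsPathJoining d γ l x y) {m : ℕ}
    {s : ℕ → ℝ} (hs : IsPartition l m s) {ε : ℝ} (hε : 0 < ε) :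
    ∃ δ > 0, ∀ (k : ℕ) (t : ℕ → ℝ), IsPartition l k t → (∀ i < k, t (i + 1) - t i < δ) →
      ∑ j ∈ Finset.range m, d (γ (s j)) (γ (s (j + 1))) ≤
        ∑ i ∈ Finset.range k, d (γ (t i)) (γ (t (i + 1))) + ε := by
  have hη : 0 < ε / (2 * m + 1) := by positivity
  obtain ⟨δ, hδ, h⟩ := hγ.uniform hd hη
  refine ⟨δ, hδ, fun k t ht hmesh => ?_⟩
  refine (ht.sum_le_sum_add hd hδ (fun a ha b hb hab => (h a ha b hb hab).le) hmesh hs).trans ?_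
  gcongr
  rw [mul_div_assoc', div_le_iff₀ (by positivity)]
  nlinarith

/-- A path whose partition sums are bounded is rectifiable, its length being their supremum. -/
lemma IsPathJoining.exists_hasLength (hd : IsMetric d) (hγ : IsPathJoining d γ l x y) {B : ℝ}
    (hB : ∀ (k : ℕ) (t : ℕ → ℝ), IsPartition l k t →
      ∑ i ∈ Finset.range k, d (γ (t i)) (γ (t (i + 1))) ≤ B) :
    ∃ L ≤ B, HasLength d γ l L := by
  set S : Set ℝ := {σ | ∃ (k : ℕ) (t : ℕ → ℝ), IsPartition l k t ∧
    σ = ∑ i ∈ Finset.range k, d (γ (t i)) (γ (t (i + 1)))} with hS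
  have hbdd : BddAbove S := ⟨B, by rintro _ ⟨k, t, ht, rfl⟩; exact hB k t ht⟩
  have hne : S.Nonempty := by
    obtain ⟨k, t, ht, -⟩ := exists_isPartition hγ.nonneg one_pos
    exact ⟨_, k, t, ht, rfl⟩
  refine ⟨sSup S, csSup_le hne (by rintro _ ⟨k, t, ht, rfl⟩; exact hB k t ht), fun ε hε => ?_⟩
  obtain ⟨_, ⟨m, s, hs, rfl⟩, hlt⟩ := exists_lt_of_lt_csSup hne (sub_lt_self (sSup S) (half_pos hε))
  obtain ⟨δ, hδ, h⟩ := hγ.exists_mesh hd hs (half_pos hε)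
  refine ⟨δ, hδ, fun k t h0 hk hlt' hmesh => ?_⟩
  have ht : IsPartition l k t := ⟨h0, hk, hlt'⟩
  have h1 := h k t ht hmesh
  have hmem : ∑ i ∈ Finset.range k, d (γ (t i)) (γ (t (i + 1))) ∈ S := ⟨k, t, ht, rfl⟩
  have h2 := le_csSup hbdd hmem
  rw [abs_lt]
  constructor <;> linarith

lemma HasLength.sum_le (hd : IsMetric d) (hγ : IsPathJoining d γ l x y) {L : ℝ}
    (hL : HasLength d γ l L) {m : ℕ} {s : ℕ → ℝ} (hs : IsPartition l m s) :
    ∑ i ∈ Finset.range m, d (γ (s i)) (γ (s (i + 1))) ≤ L := by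
  refine le_of_forall_pos_le_add fun ε hε => ?_
  obtain ⟨δ₁, hδ₁, h₁⟩ := hγ.exists_mesh hd hs (half_pos hε)
  obtain ⟨δ₂, hδ₂, h₂⟩ := hL (ε / 2) (half_pos hε)
  obtain ⟨k, t, ht, hmesh⟩ := exists_isPartition hγ.nonneg (lt_min hδ₁ hδ₂)
  have h3 := h₁ k t ht fun i hi => (hmesh i hi).trans_le (min_le_left _ _)
  have h4 := h₂ k t ht.zero ht.last ht.lt fun i hi => (hmesh i hi).trans_le (min_le_right _ _)
  rw [abs_lt] at h4
  linarith

lemma IsPathJoining.innerDist_le (hd : IsMetric d) (hγ : IsPathJoining d γ l x y) {B : ℝ}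
    (hB : ∀ (k : ℕ) (t : ℕ → ℝ), IsPartition l k t →
      ∑ i ∈ Finset.range k, d (γ (t i)) (γ (t (i + 1))) ≤ B) :
    innerDist d x y ≤ ENNReal.ofReal B := by
  obtain ⟨L, hLB, hL⟩ := hγ.exists_hasLength hd hB
  have h : innerDist d x y ≤ ENNReal.ofReal L := sInf_le ⟨γ, l, L, hγ, hL, rfl⟩
  exact h.trans (ENNReal.ofReal_le_ofReal hLB)

lemma innerDist_self (hd : IsMetric d) (x : X) : innerDist d x x = 0 := by
  have hγ : IsPathJoining d (fun _ => x) 0 x x :=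
    ⟨le_rfl, rfl, rfl, fun t _ ε hε => ⟨1, one_pos, fun s _ _ => by
      rwa [hd.self_eq_zero]⟩⟩
  simpa using hγ.innerDist_le hd (B := 0) fun k t _ => by simp [hd.self_eq_zero]

/-- Maps that do not increase distances do not increase the inner distance. -/
lemma innerDist_map_le {d' : Y → Y → ℝ} (hd : IsMetric d) (hd' : IsMetric d') {f : X → Y}
    (hf : ∀ z w, d' (f z) (f w) ≤ d z w) (x y : X) :
    innerDist d' (f x) (f y) ≤ innerDist d x y := by
  refine le_sInf ?_
  rintro _ ⟨γ, l, L, hγ, hL, rfl⟩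
  have hfγ : IsPathJoining d' (f ∘ γ) l (f x) (f y) :=
    ⟨hγ.nonneg, congrArg f hγ.source, congrArg f hγ.target, fun t ht ε hε => by
      obtain ⟨δ, hδ, h⟩ := hγ.cont t ht ε hε
      exact ⟨δ, hδ, fun s hs hst => (hf _ _).trans_lt (h s hs hst)⟩⟩
  exact hfγ.innerDist_le hd' fun k t ht =>
    (Finset.sum_le_sum fun i _ => hf _ _).trans (hL.sum_le hd hγ ht)

/-- The constants of quasiconvexity form a closed set. -/
lemma isClosed_setOf_isQuasiconvexWith (d : X → X → ℝ) :
    IsClosed {c : ℝ | IsQuasiconvexWith d c} := by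
  have : {c : ℝ | IsQuasiconvexWith d c} =
      ⋂ x, ⋂ y, {c : ℝ | innerDist d x y ≤ ENNReal.ofReal (c * d x y)} := by
    ext c
    simp [IsQuasiconvexWith]
  rw [this]
  refine isClosed_iInter fun x => isClosed_iInter fun y => isClosed_le continuous_const ?_
  exact ENNReal.continuous_ofReal.comp (by fun_prop)

end Paths

/-! ### The weight `pqM` -/

/-- The tangent at `b` lies above the graph of the concave function `a ↦ a ^ (1 - q)`. -/
lemma rpow_one_sub_le_tangent {q a b : ℝ} (hq : 0 ≤ q) (hq1 : q ≤ 1) (ha : 0 ≤ a) (hb : 0 < b) :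
    a ^ (1 - q) ≤ b ^ (1 - q) + (1 - q) * (a - b) * b ^ (-q) := by
  have h1 : -1 ≤ a / b - 1 := by linarith [div_nonneg ha hb.le]
  have h := rpow_one_add_le_one_add_mul_self h1 (by linarith : 0 ≤ 1 - q) (by linarith)
  rw [add_sub_cancel, Real.div_rpow ha hb.le, div_le_iff₀ (Real.rpow_pos_of_pos hb _)] at h
  refine h.trans_eq ?_
  have h2 : b ^ (1 - q) = b * b ^ (-q) := by
    rw [sub_eq_add_neg, Real.rpow_add hb, Real.rpow_one]
  rw [h2]
  field_simp

section Weight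

variable {p : ℝ≥0∞} {q s t s' t' : ℝ}

lemma pqM_comm (p : ℝ≥0∞) (q s t : ℝ) : pqM p q s t = pqM p q t s := by
  simp only [pqM, max_comm s t, add_comm (s ^ p.toReal)]

lemma pqM_mono (hq : 0 ≤ q) (hs : 0 ≤ s) (ht : 0 ≤ t) (hs' : s ≤ s')
    (ht' : t ≤ t') : pqM p q s t ≤ pqM p q s' t' := by
  unfold pqM
  split_ifs with h
  · gcongr
  · gcongr

lemma pqM_zero_left (hp : 0 < p) (ht : 0 ≤ t) : pqM p q 0 t = t ^ q := by
  unfold pqM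
  split_ifs with h
  · rw [max_eq_right ht]
  · have hr := ENNReal.toReal_pos hp.ne' h
    rw [Real.zero_rpow hr.ne', zero_add, ← Real.rpow_mul ht, mul_div_cancel₀ _ hr.ne']

lemma pqM_self (hp : 0 < p) (hs : 0 ≤ s) :
    pqM p q s s = 2 ^ (q * p⁻¹.toReal) * s ^ q := by
  unfold pqM
  split_ifs with h
  · simp [h]
  · have hr := ENNReal.toReal_pos hp.ne' h
    rw [← two_mul, Real.mul_rpow (by norm_num) (by positivity), ← Real.rpow_mul hs,
      mul_div_cancel₀ _ hr.ne', ENNReal.toReal_inv, div_eq_mul_inv]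

lemma pqM_nonneg (hs : 0 ≤ s) (ht : 0 ≤ t) : 0 ≤ pqM p q s t := by
  unfold pqM
  split_ifs <;> positivity

lemma pqM_pos (hp : 0 < p) (hq : 0 ≤ q) (hs : 0 ≤ s) (ht : 0 < t) : 0 < pqM p q s t :=
  (Real.rpow_pos_of_pos ht q).trans_le
    ((pqM_zero_left hp ht.le).symm.trans_le (pqM_mono hq le_rfl ht.le hs le_rfl))

lemma le_pqM (hp : 0 < p) (hq : 0 ≤ q) (hs : 0 ≤ s) (hst : s ≤ t) :
    2 ^ (q * p⁻¹.toReal) * s ^ q ≤ pqM p q s t :=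
  (pqM_self hp hs).symm.trans_le (pqM_mono hq hs hs le_rfl hst)

lemma pqM_le (hp : 0 < p) (hq : 0 ≤ q) (hs : 0 ≤ s) (hst : s ≤ t) :
    pqM p q s t ≤ 2 ^ (q * p⁻¹.toReal) * t ^ q :=
  (pqM_mono hq hs (hs.trans hst) hst le_rfl).trans_eq (pqM_self hp (hs.trans hst))

/-- Comparison of the power mean of order `p` with the arithmetic mean. -/
lemma pqM_le_add (hp : 0 < p) (hq : 0 ≤ q) (hs : 0 ≤ s) (ht : 0 ≤ t) :
    pqM p q s t ≤ max 1 (2 ^ (q * p⁻¹.toReal - q)) * (s + t) ^ q := by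
  have hst : 0 ≤ (s + t) ^ q := by positivity
  unfold pqM
  split_ifs with h
  · refine le_trans ?_ (le_mul_of_one_le_left hst (le_max_left _ _))
    gcongr
    exact max_le (by linarith) (by linarith)
  · have hr := ENNReal.toReal_pos hp.ne' h
    rw [ENNReal.toReal_inv]
    set r := p.toReal
    have e : (s ^ r + t ^ r) ^ (q / r) = ((s ^ r + t ^ r) ^ (1 / r)) ^ q := by
      rw [← Real.rpow_mul (by positivity)]
      congr 1
      ring
    rw [e]
    lift s to NNReal using hs
    lift t to NNReal using ht
    rcases le_total 1 r with h1 | h1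
    · refine le_trans ?_ (le_mul_of_one_le_left hst (le_max_left _ _))
      gcongr
      exact_mod_cast NNReal.rpow_add_rpow_le_add s t h1
    · refine le_trans ?_ (mul_le_mul_of_nonneg_right (le_max_right _ _) hst)
      have h2 : ((s : ℝ) ^ r + (t : ℝ) ^ r) ^ (1 / r) ≤ 2 ^ (1 / r - 1) * ((s : ℝ) + t) := by
        have h3 := NNReal.rpow_add_le_mul_rpow_add_rpow (s ^ r) (t ^ r)
          ((one_le_div hr).2 h1)
        rw [← NNReal.rpow_mul, ← NNReal.rpow_mul, mul_one_div_cancel hr.ne', NNReal.rpow_one,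
          NNReal.rpow_one] at h3
        exact_mod_cast h3
      refine (Real.rpow_le_rpow (by positivity) h2 hq).trans_eq ?_
      rw [Real.mul_rpow (by positivity) (by positivity), ← Real.rpow_mul (by norm_num)]
      congr 2
      field_simp

end Weight

/-! ### Relative metrics on a normed space -/

section Normed

variable {E : Type*} [NormedAddCommGroup E] {p : ℝ≥0∞} {q : ℝ}

lemma relDist_zero_left (hp : 0 < p) {x : E} (hx : x ≠ 0) :
    relDist (pqM p q) 0 x = ‖x‖ ^ (1 - q) := by
  rw [relDist, zero_sub, norm_neg, norm_zero, pqM_zero_left hp (norm_nonneg _),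
    Real.rpow_sub (norm_pos_iff.2 hx), Real.rpow_one]

/-- For `q > 1` points near the origin are far away from it, although they are at bounded
distance from a unit vector. -/
lemma le_one_of_isMetric [NormedSpace ℝ E] (hp : 0 < p)
    (hd : IsMetric (relDist (pqM p q) : E → E → ℝ)) {e : E}
    (he : ‖e‖ = 1) : q ≤ 1 := by
  by_contra! hq1
  have he0 : e ≠ 0 := by rintro rfl; simp at he
  -- `η` is chosen such that `η • e` has distance `3` from the origin
  set η : ℝ := 3 ^ (-(q - 1)⁻¹) with hη
  have hη0 : 0 < η := by positivity
  have hη1 : η ≤ 1 := Real.rpow_le_one_of_one_le_of_nonpos (by norm_num)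
    (neg_nonpos.2 (inv_nonneg.2 (by linarith)))
  have hn : ‖η • e‖ = η := by rw [norm_smul, he, mul_one, Real.norm_of_nonneg hη0.le]
  have h1 : relDist (pqM p q) 0 (η • e) = 3 := by
    rw [relDist_zero_left hp (smul_ne_zero hη0.ne' he0), hn, hη, ← Real.rpow_mul (by norm_num)]
    have : -(q - 1)⁻¹ * (1 - q) = 1 := by
      field_simp [(by linarith : q - 1 ≠ 0)]
      ring
    rw [this, Real.rpow_one]
  have h2 : relDist (pqM p q) 0 e = 1 := by
    rw [relDist_zero_left hp he0, he, Real.one_rpow]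
  have h3 : relDist (pqM p q) e (η • e) ≤ 1 := by
    have h4 : 1 ≤ pqM p q 1 η := by
      have := pqM_mono (p := p) (by linarith : 0 ≤ q) zero_le_one le_rfl (le_refl (1 : ℝ)) hη0.le
      rwa [pqM_comm, pqM_zero_left hp zero_le_one, Real.one_rpow] at this
    have h5 : e - η • e = (1 - η) • e := by rw [sub_smul, one_smul]
    rw [relDist, he, hn, h5, norm_smul, he, Real.norm_of_nonneg (by linarith)]
    exact div_le_one_of_le₀ (by linarith) (by linarith)
  linarith [hd.triangle 0 e (η • e)]

/-- The relative distance on the line is that of the line through a unit vector. -/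
lemma isMetric_real [NormedSpace ℝ E] (hd : IsMetric (relDist (pqM p q) : E → E → ℝ))
    {e : E} (he : ‖e‖ = 1) :
    IsMetric (relDist (pqM p q) : ℝ → ℝ → ℝ) := by
  have h : ∀ u v : ℝ, relDist (pqM p q) u v = relDist (pqM p q) (u • e) (v • e) := by
    intro u v
    simp only [relDist, ← sub_smul, norm_smul, he, mul_one]
  have he0 : e ≠ 0 := by rintro rfl; simp at he
  refine ⟨fun u v => ?_, fun u v => ?_, fun u v => ?_, fun u v w => ?_⟩
  · rw [h]; exact hd.nonneg _ _
  · rw [h, hd.eq_zero_iff]; exact (smul_left_injective ℝ he0).eq_iff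
  · rw [h, h]; exact hd.symm _ _
  · rw [h, h, h]; exact hd.triangle _ _ _

/-- For `q = 1` all points have distance `1` from the origin, so that no continuous path
leaves it. -/
lemma innerDist_zero_eq_top_of_eq_one (hp : 0 < p)
    (hd : IsMetric (relDist (pqM p 1) : E → E → ℝ)) {x : E} (hx : x ≠ 0) :
    innerDist (relDist (pqM p 1)) 0 x = ⊤ := by
  have h1 : ∀ z : E, z ≠ 0 → relDist (pqM p 1) z 0 = 1 := by
    intro z hz
    rw [hd.symm, relDist_zero_left hp hz, sub_self, Real.rpow_zero]
  rw [innerDist, sInf_eq_top]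
  rintro _ ⟨γ, l, L, hγ, -, rfl⟩
  exfalso
  have hc := hγ.continuousOn_dist hd 0
  have himg := intermediate_value_Icc hγ.nonneg hc
  rw [hγ.source, hγ.target, hd.self_eq_zero, h1 x hx] at himg
  obtain ⟨t, -, ht⟩ := himg (⟨by norm_num, by norm_num⟩ : (1 / 2 : ℝ) ∈ Set.Icc 0 1)
  by_cases h0 : γ t = 0
  · simp only [h0, hd.self_eq_zero] at ht
    norm_num at ht
  · simp only [h1 _ h0] at ht
    norm_num at ht

/-! ### Lower bound for the lengths of paths from the origin -/

/-- On a path that starts at the origin the norm is a function of the distance to the starting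
point, hence uniformly continuous. -/
lemma IsPathJoining.uniform_norm (hp : 0 < p) (hq1 : q < 1)
    (hd : IsMetric (relDist (pqM p q) : E → E → ℝ)) {γ : ℝ → E} {l : ℝ} {x y : E}
    (hγ : IsPathJoining (relDist (pqM p q)) γ l x y) {ε : ℝ} (hε : 0 < ε) :
    ∃ δ > 0, ∀ s ∈ Set.Icc 0 l, ∀ t ∈ Set.Icc 0 l, |s - t| < δ → |‖γ s‖ - ‖γ t‖| < ε := by
  have h1 : ∀ z : E, ‖z‖ = relDist (pqM p q) z 0 ^ (1 - q)⁻¹ := by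
    intro z
    have h0 : 1 - q ≠ 0 := by linarith
    rcases eq_or_ne z 0 with rfl | hz
    · rw [hd.self_eq_zero, norm_zero, Real.zero_rpow (inv_ne_zero h0)]
    · rw [hd.symm, relDist_zero_left hp hz, Real.rpow_rpow_inv (norm_nonneg _) h0]
  have hc : ContinuousOn (fun t => ‖γ t‖) (Set.Icc 0 l) := by
    simp only [h1]
    exact (hγ.continuousOn_dist hd 0).rpow_const fun t _ =>
      Or.inr (inv_nonneg.2 (by linarith))
  have hu := isCompact_Icc.uniformContinuousOn_of_continuous hc
  rw [Metric.uniformContinuousOn_iff] at hu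
  exact hu ε hε

/-- The shift by `ε` makes up for replacing the smaller norm by the larger one in the tangent
inequality, provided that the norms differ by at most `ε`. -/
lemma rpow_sub_rpow_le_relDist (hp : 0 < p) (hq : 0 ≤ q) (hq1 : q < 1) {ε : ℝ} (hε : 0 < ε)
    {z w : E} (hzw : ‖w‖ ≤ ‖z‖ + ε) :
    2 ^ (-(q * p⁻¹.toReal)) / (1 - q) * ((‖w‖ + ε) ^ (1 - q) - (‖z‖ + ε) ^ (1 - q)) ≤
      relDist (pqM p q) z w := by
  have hz := norm_nonneg z
  have hw := norm_nonneg w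
  have hq' : 0 < 1 - q := by linarith
  rcases le_total ‖w‖ ‖z‖ with h | h
  · refine le_trans (mul_nonpos_of_nonneg_of_nonpos (by positivity) ?_)
      (div_nonneg (norm_nonneg _) (pqM_nonneg hz hw))
    exact sub_nonpos.2 (by gcongr)
  rcases hw.eq_or_lt with hw0 | hw0
  · have : ‖z‖ = ‖w‖ := by linarith
    rw [this, sub_self, mul_zero]
    exact div_nonneg (norm_nonneg _) (pqM_nonneg hz hw)
  have h1 := rpow_one_sub_le_tangent hq hq1.le (by positivity : 0 ≤ ‖w‖ + ε)
    (by positivity : 0 < ‖z‖ + ε)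
  have h2 : (‖z‖ + ε) ^ (-q) ≤ ‖w‖ ^ (-q) :=
    Real.rpow_le_rpow_of_nonpos hw0 hzw (by linarith)
  have h3 : (‖w‖ + ε) ^ (1 - q) - (‖z‖ + ε) ^ (1 - q) ≤ (1 - q) * ((‖w‖ - ‖z‖) * ‖w‖ ^ (-q)) := by
    have : (‖w‖ - ‖z‖) * (‖z‖ + ε) ^ (-q) ≤ (‖w‖ - ‖z‖) * ‖w‖ ^ (-q) :=
      mul_le_mul_of_nonneg_left h2 (by linarith)
    nlinarith
  have hM := pqM_pos (p := p) hp hq hz hw0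
  have h4 : ‖w‖ - ‖z‖ ≤ ‖z - w‖ := by rw [norm_sub_rev]; exact norm_sub_norm_le w z
  calc _ ≤ 2 ^ (-(q * p⁻¹.toReal)) / (1 - q) * ((1 - q) * ((‖w‖ - ‖z‖) * ‖w‖ ^ (-q))) := by gcongr
    _ = (‖w‖ - ‖z‖) / (2 ^ (q * p⁻¹.toReal) * ‖w‖ ^ q) := by
      rw [Real.rpow_neg (by norm_num), Real.rpow_neg hw]
      field_simp
    _ ≤ ‖z - w‖ / pqM p q ‖z‖ ‖w‖ :=
      div_le_div₀ (norm_nonneg _) h4 hM (pqM_le hp hq hz h)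

/-- Compare the sums along a fine partition with the increments of
`(‖γ t‖ + ε) ^ (1 - q) / (1 - q)`, then let `ε` tend to `0`. -/
lemma le_innerDist_zero (hp : 0 < p) (hq : 0 ≤ q) (hq1 : q < 1)
    (hd : IsMetric (relDist (pqM p q) : E → E → ℝ)) (x : E) :
    ENNReal.ofReal (2 ^ (-(q * p⁻¹.toReal)) / (1 - q) * ‖x‖ ^ (1 - q)) ≤
      innerDist (relDist (pqM p q)) 0 x := by
  refine le_sInf ?_
  rintro _ ⟨γ, l, L, hγ, hL, rfl⟩
  refine ENNReal.ofReal_le_ofReal ?_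
  have hq' : 0 < 1 - q := by linarith
  set C : ℝ := 2 ^ (-(q * p⁻¹.toReal)) / (1 - q)
  have key : ∀ ε > 0, C * ((‖x‖ + ε) ^ (1 - q) - (0 + ε) ^ (1 - q)) ≤ L := by
    intro ε hε
    obtain ⟨δ, hδ, h⟩ := hγ.uniform_norm hp hq1 hd hε
    obtain ⟨k, t, ht, hmesh⟩ := exists_isPartition hγ.nonneg hδ
    refine le_trans ?_ (hL.sum_le hd hγ ht)
    have htel := Finset.sum_range_sub (fun i => C * (‖γ (t i)‖ + ε) ^ (1 - q)) k
    simp only [ht.zero, ht.last, hγ.source, hγ.target, norm_zero] at htel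
    rw [mul_sub, ← htel]
    refine Finset.sum_le_sum fun i hi => ?_
    rw [← mul_sub]
    have hi := Finset.mem_range.1 hi
    refine rpow_sub_rpow_le_relDist hp hq hq1 hε ?_
    have h1 := h _ (ht.mem_Icc (Nat.succ_le_of_lt hi)) _ (ht.mem_Icc hi.le) (by
      rw [abs_of_pos (sub_pos.2 (ht.lt i hi))]
      exact hmesh i hi)
    linarith [(abs_lt.1 h1).2]
  have hlim : Filter.Tendsto (fun ε : ℝ => C * ((‖x‖ + ε) ^ (1 - q) - (0 + ε) ^ (1 - q)))
      (nhdsWithin 0 (Set.Ioi 0)) (nhds (C * (‖x‖ ^ (1 - q)))) := by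
    have hc : Continuous (fun ε : ℝ => C * ((‖x‖ + ε) ^ (1 - q) - (0 + ε) ^ (1 - q))) :=
      continuous_const.mul
        (((continuous_const.add continuous_id).rpow_const fun _ => Or.inr hq'.le).sub
          ((continuous_const.add continuous_id).rpow_const fun _ => Or.inr hq'.le))
    have h0 := hc.tendsto 0
    simp only [add_zero, Real.zero_rpow hq'.ne', sub_zero] at h0
    exact h0.mono_left nhdsWithin_le_nhds
  exact le_of_tendsto hlim (Filter.eventually_of_mem self_mem_nhdsWithin key)

end Normed

/-! ### Chords on the real line -/

section Real

variable {p : ℝ≥0∞} {q : ℝ}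

/-- The chord inequality up to a factor `(b / a) ^ (q / 2 ^ k)`, which is halved in the exponent
by inserting the geometric mean of `a` and `b`. -/
lemma relDist_le_rpow_mul (hp : 0 < p) (hq : 0 ≤ q) (hq1 : q < 1)
    (hd : IsMetric (relDist (pqM p q) : ℝ → ℝ → ℝ)) (k : ℕ) {a b : ℝ} (ha : 0 < a) (hab : a ≤ b) :
    relDist (pqM p q) a b ≤ (b / a) ^ (q / 2 ^ k) *
      (2 ^ (-(q * p⁻¹.toReal)) / (1 - q) * (b ^ (1 - q) - a ^ (1 - q))) := by
  have hq' : 0 < 1 - q := by linarith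
  set C : ℝ := 2 ^ (-(q * p⁻¹.toReal)) / (1 - q) with hC
  induction k generalizing a b with
  | zero =>
    have hb : 0 < b := ha.trans_le hab
    have h1 := rpow_one_sub_le_tangent hq hq1.le ha.le hb
    have h2 : (1 - q) * ((b - a) * b ^ (-q)) ≤ b ^ (1 - q) - a ^ (1 - q) := by
      linarith [mul_assoc (1 - q) (a - b) (b ^ (-q))]
    calc relDist (pqM p q) a b = (b - a) / pqM p q a b := by
          rw [relDist, norm_sub_rev, Real.norm_of_nonneg (sub_nonneg.2 hab),
            Real.norm_of_nonneg ha.le, Real.norm_of_nonneg hb.le]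
      _ ≤ (b - a) / (2 ^ (q * p⁻¹.toReal) * a ^ q) := by
          have := le_pqM hp hq ha.le hab
          have : 0 ≤ b - a := by linarith
          gcongr
      _ = (b / a) ^ (q / 2 ^ 0) * (C * ((1 - q) * ((b - a) * b ^ (-q)))) := by
          rw [hC, Real.rpow_neg (by norm_num), Real.rpow_neg hb.le, Real.div_rpow hb.le ha.le,
            pow_zero, div_one]
          have := (Real.rpow_pos_of_pos hb q).ne'
          field_simp
      _ ≤ _ := by gcongr
  | succ k ih =>
    have hb : 0 < b := ha.trans_le hab
    set m := √(a * b) with hm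
    have hmm : m * m = a * b := Real.mul_self_sqrt (by positivity)
    have hm0 : 0 < m := Real.sqrt_pos.2 (by positivity)
    have ham : a ≤ m := by
      by_contra! h
      nlinarith
    have hmb : m ≤ b := by
      by_contra! h
      nlinarith
    have e1 : m / a = (b / a) ^ (1 / 2 : ℝ) := by
      rw [← Real.sqrt_eq_rpow, eq_comm, Real.sqrt_eq_iff_mul_self_eq (by positivity) (by positivity)]
      field_simp
      nlinarith
    have e2 : b / m = (b / a) ^ (1 / 2 : ℝ) := by
      rw [← e1]
      field_simp
      nlinarith
    have e3 : ((b / a) ^ (1 / 2 : ℝ)) ^ (q / 2 ^ k) = (b / a) ^ (q / 2 ^ (k + 1)) := by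
      rw [← Real.rpow_mul (by positivity)]
      congr 1
      rw [pow_succ]
      field_simp
    have h1 := ih ha ham
    have h2 := ih hm0 hmb
    rw [e1, e3] at h1
    rw [e2, e3] at h2
    have h3 := hd.triangle a m b
    linarith

lemma relDist_le_of_pos (hp : 0 < p) (hq : 0 ≤ q) (hq1 : q < 1)
    (hd : IsMetric (relDist (pqM p q) : ℝ → ℝ → ℝ)) {a b : ℝ} (ha : 0 < a) (hab : a ≤ b) :
    relDist (pqM p q) a b ≤
      2 ^ (-(q * p⁻¹.toReal)) / (1 - q) * (b ^ (1 - q) - a ^ (1 - q)) := by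
  set R := 2 ^ (-(q * p⁻¹.toReal)) / (1 - q) * (b ^ (1 - q) - a ^ (1 - q))
  have h0 : Filter.Tendsto (fun k : ℕ => q / 2 ^ k) Filter.atTop (nhds 0) :=
    tendsto_const_nhds.div_atTop (tendsto_pow_atTop_atTop_of_one_lt (by norm_num))
  have h1 : Filter.Tendsto (fun k : ℕ => (b / a) ^ (q / 2 ^ k) * R) Filter.atTop
      (nhds ((b / a) ^ (0 : ℝ) * R)) :=
    ((tendsto_const_nhds (x := b / a)).rpow h0
      (Or.inl (div_pos (ha.trans_le hab) ha).ne')).mul_const R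
  rw [Real.rpow_zero, one_mul] at h1
  exact ge_of_tendsto' h1 fun k => relDist_le_rpow_mul hp hq hq1 hd k ha hab

/-- The odd extension of `u ^ (1 - q)`, an antiderivative of `(1 - q) * |u| ^ (-q)`. -/
noncomputable def signedRpow (q u : ℝ) : ℝ := max u 0 ^ (1 - q) - max (-u) 0 ^ (1 - q)

lemma signedRpow_of_nonneg (hq1 : q < 1) {u : ℝ} (hu : 0 ≤ u) : signedRpow q u = u ^ (1 - q) := by
  rw [signedRpow, max_eq_left hu, max_eq_right (by linarith), Real.zero_rpow (by linarith), sub_zero]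

lemma signedRpow_neg (q u : ℝ) : signedRpow q (-u) = -signedRpow q u := by
  simp only [signedRpow, neg_neg, neg_sub]

lemma continuous_signedRpow (hq1 : q < 1) : Continuous (signedRpow q) :=
  ((continuous_id.max continuous_const).rpow_const fun _ => Or.inr (by linarith)).sub
    ((continuous_neg.max continuous_const).rpow_const fun _ => Or.inr (by linarith))

/-- If the relative distance is a metric on the line, it is bounded by the length of the segment
for the density `2 ^ (-q / p) * |u| ^ (-q)`. -/
lemma relDist_le_signedRpow (hp : 0 < p) (hq : 0 ≤ q) (hq1 : q < 1)
    (hd : IsMetric (relDist (pqM p q) : ℝ → ℝ → ℝ)) {u v : ℝ} (huv : u ≤ v) :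
    relDist (pqM p q) u v ≤
      2 ^ (-(q * p⁻¹.toReal)) / (1 - q) * (signedRpow q v - signedRpow q u) := by
  have hq' : 0 < 1 - q := by linarith
  set C : ℝ := 2 ^ (-(q * p⁻¹.toReal)) / (1 - q) with hC
  -- from the triangle inequality for the points `0`, `1 / 2`, `1`
  have hC1 : 1 ≤ C := by
    have h1 := relDist_le_of_pos hp hq hq1 hd (by norm_num : (0 : ℝ) < 1 / 2)
      (by norm_num : (1 / 2 : ℝ) ≤ 1)
    have h2 := hd.triangle 0 (1 / 2) 1
    rw [relDist_zero_left hp one_ne_zero, relDist_zero_left hp (by norm_num)] at h2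
    rw [Real.one_rpow, ← hC] at h1
    norm_num at h2
    have h3 : (1 / 2 : ℝ) ^ (1 - q) < 1 :=
      Real.rpow_lt_one (by norm_num) (by norm_num) hq'
    norm_num at h1 h3
    nlinarith
  have hpos : ∀ a b : ℝ, 0 ≤ a → a ≤ b →
      relDist (pqM p q) a b ≤ C * (signedRpow q b - signedRpow q a) := by
    intro a b ha hab
    rw [signedRpow_of_nonneg hq1 ha, signedRpow_of_nonneg hq1 (ha.trans hab)]
    rcases ha.eq_or_lt with rfl | ha
    · rw [Real.zero_rpow hq'.ne', sub_zero]
      rcases hab.eq_or_lt with rfl | hb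
      · rw [hd.self_eq_zero]
        positivity
      · rw [relDist_zero_left hp hb.ne', Real.norm_of_nonneg hb.le]
        exact le_mul_of_one_le_left (by positivity) hC1
    · exact relDist_le_of_pos hp hq hq1 hd ha hab
  have hneg : ∀ a b : ℝ, b ≤ 0 → a ≤ b →
      relDist (pqM p q) a b ≤ C * (signedRpow q b - signedRpow q a) := by
    intro a b hb hab
    have h := hpos (-b) (-a) (by linarith) (by linarith)
    rw [signedRpow_neg, signedRpow_neg] at h
    have e : relDist (pqM p q) (-b) (-a) = relDist (pqM p q) a b := by
      simp only [relDist, norm_neg, neg_sub_neg, pqM_comm p q ‖b‖]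
    rw [e] at h
    linarith
  rcases le_total 0 u with hu | hu
  · exact hpos u v hu huv
  rcases le_total v 0 with hv | hv
  · exact hneg u v hv huv
  · have h1 := hneg u 0 le_rfl hu
    have h2 := hpos 0 v le_rfl hv
    have h3 := hd.triangle u 0 v
    linarith

end Real

/-! ### Upper bound by segments -/

section Segment

variable {E : Type*} [NormedAddCommGroup E] [NormedSpace ℝ E] {p : ℝ≥0∞} {q : ℝ}

/-- The chords of the segment from `x` to `y` are compared with those of `[-‖x‖, ‖y‖]`, which at
each parameter is at most as far from the origin. -/
lemma relDist_segment_le (hp : 0 < p) (hq : 0 ≤ q) (hq1 : q < 1)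
    (hd : IsMetric (relDist (pqM p q) : ℝ → ℝ → ℝ)) {x y : E} (hxy : 0 < ‖x‖ + ‖y‖) {a b : ℝ}
    (ha : 0 ≤ a) (hab : a ≤ b) (hb : b ≤ 1) :
    relDist (pqM p q) (x + a • (y - x)) (x + b • (y - x)) ≤
      ‖x - y‖ / (‖x‖ + ‖y‖) * (2 ^ (-(q * p⁻¹.toReal)) / (1 - q)) *
        (signedRpow q (b * (‖x‖ + ‖y‖) - ‖x‖) - signedRpow q (a * (‖x‖ + ‖y‖) - ‖x‖)) := by
  set S := ‖x‖ + ‖y‖ with hS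
  rcases hab.eq_or_lt with rfl | hab
  · simp [relDist]
  have hnorm : ∀ τ : ℝ, 0 ≤ τ → τ ≤ 1 → ‖τ * S - ‖x‖‖ ≤ ‖x + τ • (y - x)‖ := by
    intro τ h0 h1
    have e1 : x + τ • (y - x) = τ • y - (-((1 - τ) • x)) := by module
    have h2 := abs_norm_sub_norm_le (τ • y) (-((1 - τ) • x))
    rw [← e1, norm_neg, norm_smul, norm_smul, Real.norm_of_nonneg h0,
      Real.norm_of_nonneg (by linarith : 0 ≤ 1 - τ)] at h2
    rw [Real.norm_eq_abs]
    refine le_trans (le_of_eq ?_) h2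
    congr 1
    rw [hS]
    ring
  have h1 := relDist_le_signedRpow hp hq hq1 hd
    (by nlinarith : a * S - ‖x‖ ≤ b * S - ‖x‖)
  have hMpos : 0 < pqM p q ‖a * S - ‖x‖‖ ‖b * S - ‖x‖‖ := by
    rcases eq_or_ne (b * S - ‖x‖) 0 with h | h
    · rw [pqM_comm]
      refine pqM_pos hp hq (norm_nonneg _) (norm_pos_iff.2 fun h' => ?_)
      nlinarith
    · exact pqM_pos hp hq (norm_nonneg _) (norm_pos_iff.2 h)
  have hM := pqM_mono (p := p) hq (norm_nonneg _) (norm_nonneg _)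
    (hnorm a ha (hab.le.trans hb)) (hnorm b (ha.trans hab.le) hb)
  have e2 : (x + a • (y - x)) - (x + b • (y - x)) = (b - a) • (x - y) := by module
  have e3 : ‖a * S - ‖x‖ - (b * S - ‖x‖)‖ = (b - a) * S := by
    have : a * S - ‖x‖ - (b * S - ‖x‖) = -((b - a) * S) := by ring
    rw [this, norm_neg, Real.norm_of_nonneg (mul_nonneg (by linarith) hxy.le)]
  calc relDist (pqM p q) (x + a • (y - x)) (x + b • (y - x))
      ≤ (b - a) * ‖x - y‖ / pqM p q ‖a * S - ‖x‖‖ ‖b * S - ‖x‖‖ := by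
        rw [relDist, e2, norm_smul, Real.norm_of_nonneg (by linarith : 0 ≤ b - a)]
        have : 0 ≤ (b - a) * ‖x - y‖ := mul_nonneg (by linarith) (norm_nonneg _)
        gcongr
    _ = ‖x - y‖ / S * relDist (pqM p q) (a * S - ‖x‖) (b * S - ‖x‖) := by
        rw [relDist, e3]
        field_simp
    _ ≤ _ := by
        rw [mul_assoc]
        gcongr

/-- The bound is the length, for the density `2 ^ (-q / p) * |u| ^ (-q)`, of the segment
`[-‖x‖, ‖y‖]` of the real line, rescaled to the length `‖x - y‖`. -/
lemma innerDist_le_segment (hp : 0 < p) (hq : 0 ≤ q) (hq1 : q < 1)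
    (hd : IsMetric (relDist (pqM p q) : E → E → ℝ)) (hdR : IsMetric (relDist (pqM p q) : ℝ → ℝ → ℝ))
    {x y : E} (hxy : 0 < ‖x‖ + ‖y‖) :
    innerDist (relDist (pqM p q)) x y ≤ ENNReal.ofReal (‖x - y‖ / (‖x‖ + ‖y‖) *
      (2 ^ (-(q * p⁻¹.toReal)) / (1 - q)) * (‖x‖ ^ (1 - q) + ‖y‖ ^ (1 - q))) := by
  have hq' : 0 < 1 - q := by linarith
  set S := ‖x‖ + ‖y‖ with hS
  set K := ‖x - y‖ / S * (2 ^ (-(q * p⁻¹.toReal)) / (1 - q)) with hK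
  set G : ℝ → ℝ := fun τ => K * signedRpow q (τ * S - ‖x‖) with hG
  set γ : ℝ → E := fun τ => x + τ • (y - x) with hγ_def
  have hle : ∀ a b, 0 ≤ a → a ≤ b → b ≤ 1 → relDist (pqM p q) (γ a) (γ b) ≤ G b - G a := by
    intro a b ha hab hb
    rw [hG, ← mul_sub]
    exact relDist_segment_le hp hq hq1 hdR hxy ha hab hb
  have hGc : Continuous G :=
    continuous_const.mul ((continuous_signedRpow hq1).comp (by fun_prop))
  have hγ : IsPathJoining (relDist (pqM p q)) γ 1 x y := by
    refine ⟨zero_le_one, by simp [hγ_def], by simp [hγ_def], fun t ht ε hε => ?_⟩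
    obtain ⟨δ, hδ, h⟩ := Metric.continuous_iff.1 hGc t ε hε
    refine ⟨δ, hδ, fun s hs hst => ?_⟩
    have h1 := abs_lt.1 (h s hst)
    rcases le_total s t with hle' | hle'
    · linarith [hle s t hs.1 hle' ht.2]
    · rw [hd.symm]
      linarith [hle t s ht.1 hle' hs.2]
  refine hγ.innerDist_le hd fun k t ht => ?_
  have htel := Finset.sum_range_sub (fun i => G (t i)) k
  have e0 : G 0 = -(K * ‖x‖ ^ (1 - q)) := by
    simp only [hG, zero_mul, zero_sub, signedRpow_neg, signedRpow_of_nonneg hq1 (norm_nonneg x),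
      mul_neg]
  have e1 : G 1 = K * ‖y‖ ^ (1 - q) := by
    simp only [hG, hS, one_mul, add_sub_cancel_left, signedRpow_of_nonneg hq1 (norm_nonneg y)]
  have e2 : K * (‖x‖ ^ (1 - q) + ‖y‖ ^ (1 - q)) =
      ∑ i ∈ Finset.range k, (G (t (i + 1)) - G (t i)) := by
    rw [htel, ht.zero, ht.last, e0, e1]
    ring
  rw [e2]
  refine Finset.sum_le_sum fun i hi => ?_
  have hi := Finset.mem_range.1 hi
  exact hle _ _ (ht.mem_Icc hi.le).1 (ht.lt i hi).le (ht.mem_Icc (Nat.succ_le_of_lt hi)).2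

lemma isQuasiconvexWith_relDist (hp : 0 < p) (hq : 0 ≤ q) (hq1 : q < 1)
    (hd : IsMetric (relDist (pqM p q) : E → E → ℝ))
    (hdR : IsMetric (relDist (pqM p q) : ℝ → ℝ → ℝ)) :
    IsQuasiconvexWith (relDist (pqM p q) : E → E → ℝ)
      (max ((2 : ℝ) ^ (q * (1 - p⁻¹.toReal))) 1 / (1 - q)) := by
  intro x y
  have hq' : 0 < 1 - q := by linarith
  rcases eq_or_ne x y with rfl | hne
  · rw [innerDist_self hd]
    exact zero_le
  have hx := norm_nonneg x
  have hy := norm_nonneg y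
  have hxy : 0 < ‖x‖ + ‖y‖ :=
    (norm_pos_iff.2 (sub_ne_zero.2 hne)).trans_le (norm_sub_le x y)
  refine (innerDist_le_segment hp hq hq1 hd hdR hxy).trans (ENNReal.ofReal_le_ofReal ?_)
  set S := ‖x‖ + ‖y‖ with hS
  set P := q * p⁻¹.toReal with hP
  have hM : 0 < pqM p q ‖x‖ ‖y‖ := by
    rcases hx.eq_or_lt with h | h
    · exact pqM_pos hp hq hx (by linarith)
    · rw [pqM_comm]
      exact pqM_pos hp hq hy h
  -- concavity of `u ↦ u ^ (1 - q)` at the mean of the two norms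
  have h1 : ‖x‖ ^ (1 - q) + ‖y‖ ^ (1 - q) ≤ S * (2 ^ q * S ^ (-q)) := by
    have ha := rpow_one_sub_le_tangent hq hq1.le hx (half_pos hxy)
    have hb := rpow_one_sub_le_tangent hq hq1.le hy (half_pos hxy)
    have hc : (S / 2) ^ (1 - q) = S / 2 * (2 ^ q * S ^ (-q)) := by
      rw [sub_eq_add_neg, Real.rpow_add (half_pos hxy), Real.rpow_one,
        Real.div_rpow hxy.le (by norm_num), Real.rpow_neg (by norm_num : (0 : ℝ) ≤ 2)]
      field_simp
    have hd : (1 - q) * (‖x‖ - S / 2) * (S / 2) ^ (-q) +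
        (1 - q) * (‖y‖ - S / 2) * (S / 2) ^ (-q) = 0 := by
      rw [hS]
      ring
    linarith
  have h2 : 2 ^ (-P) * (2 ^ q * S ^ (-q)) * pqM p q ‖x‖ ‖y‖ ≤
      max ((2 : ℝ) ^ (q * (1 - p⁻¹.toReal))) 1 := by
    have h3 := pqM_le_add hp hq hx hy
    have e : (2 : ℝ) ^ (q * (1 - p⁻¹.toReal)) = 2 ^ (-P) * 2 ^ q := by
      rw [← Real.rpow_add (by norm_num), hP]
      congr 1
      ring
    have e' : (2 : ℝ) ^ (-P) * 2 ^ q * 2 ^ (P - q) = 1 := by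
      rw [← Real.rpow_add (by norm_num), ← Real.rpow_add (by norm_num)]
      norm_num
    calc 2 ^ (-P) * (2 ^ q * S ^ (-q)) * pqM p q ‖x‖ ‖y‖
        ≤ 2 ^ (-P) * (2 ^ q * S ^ (-q)) * (max 1 (2 ^ (P - q)) * S ^ q) := by gcongr
      _ = 2 ^ (-P) * 2 ^ q * max 1 (2 ^ (P - q)) := by
        rw [Real.rpow_neg hxy.le]
        have := (Real.rpow_pos_of_pos hxy q).ne'
        field_simp
      _ = _ := by rw [mul_max_of_nonneg _ _ (by positivity), e', mul_one, e]
  calc ‖x - y‖ / S * (2 ^ (-P) / (1 - q)) * (‖x‖ ^ (1 - q) + ‖y‖ ^ (1 - q))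
      ≤ ‖x - y‖ / S * (2 ^ (-P) / (1 - q)) * (S * (2 ^ q * S ^ (-q))) := by gcongr
    _ = 2 ^ (-P) * (2 ^ q * S ^ (-q)) * pqM p q ‖x‖ ‖y‖ / (1 - q) *
        (‖x - y‖ / pqM p q ‖x‖ ‖y‖) := by field_simp
    _ ≤ max ((2 : ℝ) ^ (q * (1 - p⁻¹.toReal))) 1 / (1 - q) * relDist (pqM p q) x y := by
      rw [relDist]
      gcongr

end Segment

/-! ### Independence of the dimension -/

section Inner

open scoped RealInnerProductSpace

variable {E F : Type*} [NormedAddCommGroup E] [InnerProductSpace ℝ E]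
  [NormedAddCommGroup F] [InnerProductSpace ℝ F]

lemma norm_sq_smul_add_smul {u v : E} (hu : ‖u‖ = 1) (hv : ‖v‖ = 1) (huv : ⟪u, v⟫ = 0)
    (a b : ℝ) : ‖a • u + b • v‖ ^ 2 = a ^ 2 + b ^ 2 := by
  rw [norm_add_sq_real, inner_smul_left, inner_smul_right, huv, norm_smul, norm_smul, hu, hv]
  simp

lemma exists_norm_eq_one (h : 1 ≤ Module.finrank ℝ E) : ∃ u : E, ‖u‖ = 1 := by
  have : Nontrivial E := Module.nontrivial_of_finrank_pos (R := ℝ) h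
  exact exists_norm_eq E zero_le_one

lemma exists_norm_eq_one_inner_eq_zero (h : 2 ≤ Module.finrank ℝ E) (u : E) :
    ∃ v : E, ‖v‖ = 1 ∧ ⟪u, v⟫ = 0 := by
  have : FiniteDimensional ℝ E := Module.finite_of_finrank_pos (by omega)
  have h1 := Submodule.finrank_add_finrank_orthogonal (ℝ ∙ u)
  have h2 : Module.finrank ℝ (ℝ ∙ u) ≤ 1 := by
    simpa using finrank_span_le_card (R := ℝ) ({u} : Set E)
  obtain ⟨v, hv⟩ := exists_norm_eq_one (E := (ℝ ∙ u)ᗮ) (by omega)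
  exact ⟨v, hv, Submodule.mem_orthogonal_singleton_iff_inner_right.1 v.2⟩

/-- Two vectors in terms of an orthonormal pair, the second one in the upper half plane. -/
lemma exists_orthonormal_coordinates (h : 2 ≤ Module.finrank ℝ E) (x y : E) :
    ∃ (u v : E) (s a b : ℝ), ‖u‖ = 1 ∧ ‖v‖ = 1 ∧ ⟪u, v⟫ = 0 ∧ 0 ≤ b ∧
      x = s • u ∧ y = a • u + b • v := by
  have normalize : ∀ w : E, w ≠ 0 → ‖‖w‖⁻¹ • w‖ = 1 ∧ w = ‖w‖ • ‖w‖⁻¹ • w := by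
    intro w hw
    have := norm_ne_zero_iff.2 hw
    refine ⟨by rw [norm_smul, norm_inv, norm_norm, inv_mul_cancel₀ this], ?_⟩
    rw [smul_smul, mul_inv_cancel₀ this, one_smul]
  obtain ⟨u, s, hu, hx⟩ : ∃ (u : E) (s : ℝ), ‖u‖ = 1 ∧ x = s • u := by
    rcases eq_or_ne x 0 with rfl | hx
    · obtain ⟨u, hu⟩ := exists_norm_eq_one (E := E) (by omega)
      exact ⟨u, 0, hu, by simp⟩
    · exact ⟨_, _, normalize x hx⟩
  set w := y - ⟪u, y⟫ • u with hw
  have huw : ⟪u, w⟫ = 0 := by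
    rw [hw, inner_sub_right, inner_smul_right, real_inner_self_eq_norm_sq, hu]
    ring
  have hy : y = ⟪u, y⟫ • u + w := by rw [hw, add_sub_cancel]
  rcases eq_or_ne w 0 with h0 | h0
  · obtain ⟨v, hv, huv⟩ := exists_norm_eq_one_inner_eq_zero h u
    exact ⟨u, v, s, ⟪u, y⟫, 0, hu, hv, huv, le_rfl, hx, by
      rwa [zero_smul, ← h0]⟩
  · refine ⟨u, ‖w‖⁻¹ • w, s, ⟪u, y⟫, ‖w‖, hu, (normalize w h0).1, ?_, norm_nonneg _, hx, ?_⟩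
    · rw [inner_smul_right, huw, mul_zero]
    · rw [← (normalize w h0).2]
      exact hy

/-- Folding: in the space `E` with the unit vector `e` all half planes bounded by the line through
`e` are mapped to the half plane spanned by the orthonormal pair `u`, `v`. -/
noncomputable def foldMap (e : E) (u v : F) (z : E) : F :=
  ⟪e, z⟫ • u + ‖z - ⟪e, z⟫ • e‖ • v

variable {e : E} {u v : F}

lemma norm_sq_sub_inner_smul (he : ‖e‖ = 1) (z : E) :
    ‖z‖ ^ 2 = ⟪e, z⟫ ^ 2 + ‖z - ⟪e, z⟫ • e‖ ^ 2 := by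
  rw [norm_sub_sq_real, inner_smul_right, norm_smul, he, real_inner_comm, mul_one,
    Real.norm_eq_abs, sq_abs]
  ring

lemma norm_foldMap (he : ‖e‖ = 1) (hu : ‖u‖ = 1) (hv : ‖v‖ = 1) (huv : ⟪u, v⟫ = 0) (z : E) :
    ‖foldMap e u v z‖ = ‖z‖ := by
  rw [← sq_eq_sq₀ (norm_nonneg _) (norm_nonneg _), foldMap, norm_sq_smul_add_smul hu hv huv,
    norm_sq_sub_inner_smul he z]

lemma norm_foldMap_sub_le (he : ‖e‖ = 1) (hu : ‖u‖ = 1) (hv : ‖v‖ = 1) (huv : ⟪u, v⟫ = 0)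
    (z w : E) : ‖foldMap e u v z - foldMap e u v w‖ ≤ ‖z - w‖ := by
  rw [← sq_le_sq₀ (norm_nonneg _) (norm_nonneg _), norm_sq_sub_inner_smul he (z - w)]
  have e1 : foldMap e u v z - foldMap e u v w = (⟪e, z⟫ - ⟪e, w⟫) • u +
      (‖z - ⟪e, z⟫ • e‖ - ‖w - ⟪e, w⟫ • e‖) • v := by
    simp only [foldMap]
    module
  have e2 : z - w - ⟪e, z - w⟫ • e = (z - ⟪e, z⟫ • e) - (w - ⟪e, w⟫ • e) := by
    rw [inner_sub_right]
    module
  rw [e1, norm_sq_smul_add_smul hu hv huv, e2, inner_sub_right]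
  have := abs_norm_sub_norm_le (z - ⟪e, z⟫ • e) (w - ⟪e, w⟫ • e)
  refine add_le_add le_rfl ?_
  rwa [sq_le_sq, abs_norm]

lemma foldMap_smul_add_smul {e' : E} (he : ‖e‖ = 1) (he' : ‖e'‖ = 1) (hee' : ⟪e, e'⟫ = 0)
    (a : ℝ) {b : ℝ} (hb : 0 ≤ b) : foldMap e u v (a • e + b • e') = a • u + b • v := by
  have h : ⟪e, a • e + b • e'⟫ = a := by
    rw [inner_add_right, inner_smul_right, inner_smul_right, hee', real_inner_self_eq_norm_sq, he]
    ring
  rw [foldMap, h, add_sub_cancel_left, norm_smul, he', Real.norm_of_nonneg hb, mul_one]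

/-- The constants of quasiconvexity pass from one inner product space of dimension at least two to
every other one, since folding onto a half plane shortens paths. -/
lemma IsQuasiconvexWith.of_finrank {p : ℝ≥0∞} {q c : ℝ}
    (hE : 2 ≤ Module.finrank ℝ E) (hF : 2 ≤ Module.finrank ℝ F)
    (hdE : IsMetric (relDist (pqM p q) : E → E → ℝ))
    (hdF : IsMetric (relDist (pqM p q) : F → F → ℝ))
    (h : IsQuasiconvexWith (relDist (pqM p q) : E → E → ℝ) c) :
    IsQuasiconvexWith (relDist (pqM p q) : F → F → ℝ) c := by
  intro x y
  obtain ⟨u, v, s, a, b, hu, hv, huv, hb, rfl, rfl⟩ := exists_orthonormal_coordinates hF x y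
  obtain ⟨e, he⟩ := exists_norm_eq_one (E := E) (by omega)
  obtain ⟨e', he', hee'⟩ := exists_norm_eq_one_inner_eq_zero hE e
  have hle : ∀ z w, relDist (pqM p q) (foldMap e u v z) (foldMap e u v w) ≤
      relDist (pqM p q) z w := by
    intro z w
    rw [relDist, relDist, norm_foldMap he hu hv huv, norm_foldMap he hu hv huv]
    exact div_le_div_of_nonneg_right (norm_foldMap_sub_le he hu hv huv z w)
      (pqM_nonneg (norm_nonneg _) (norm_nonneg _))
  have hx : foldMap e u v (s • e) = s • u := by
    have := foldMap_smul_add_smul (u := u) (v := v) he he' hee' s le_rfl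
    simpa using this
  have hy := foldMap_smul_add_smul (u := u) (v := v) he he' hee' a hb
  have h1 := innerDist_map_le hdE hdF hle (s • e) (a • e + b • e')
  rw [hx, hy] at h1
  refine (h1.trans (h _ _)).trans_eq ?_
  have e1 : ‖s • e - (a • e + b • e')‖ = ‖s • u - (a • u + b • v)‖ := by
    have r1 : s • e - (a • e + b • e') = (s - a) • e + (-b) • e' := by module
    have r2 : s • u - (a • u + b • v) = (s - a) • u + (-b) • v := by module
    rw [← sq_eq_sq₀ (norm_nonneg _) (norm_nonneg _), r1, r2, norm_sq_smul_add_smul hu hv huv,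
      norm_sq_smul_add_smul he he' hee']
  have e2 : relDist (pqM p q) (s • e) (a • e + b • e') =
      relDist (pqM p q) (s • u) (a • u + b • v) := by
    rw [relDist, relDist, e1, ← norm_foldMap he hu hv huv (s • e),
      ← norm_foldMap he hu hv huv (a • e + b • e'), hx, hy]
  rw [e2]

/-! ### Small balls for `p < ∞` -/

/-- On a compact interval of positive numbers the square dominates small multiples of a smooth
function. -/
lemma exists_convexOn_sq_sub_mul {f : ℝ → ℝ} (hf : ContDiffOn ℝ 2 f (Set.Ioi 0)) {a b : ℝ}
    (ha : 0 < a) :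
    ∃ ε₀ > 0, ∀ ε, 0 ≤ ε → ε ≤ ε₀ → ConvexOn ℝ (Set.Icc a b) (fun τ => τ ^ 2 - ε * f τ) ∧
      MonotoneOn (fun τ => τ ^ 2 - ε * f τ) (Set.Icc a b) := by
  have hsub : Set.Icc a b ⊆ Set.Ioi 0 := fun τ hτ => ha.trans_le hτ.1
  have hf1 : ContDiffOn ℝ 1 (deriv f) (Set.Ioi 0) :=
    hf.deriv_of_isOpen isOpen_Ioi (by norm_num)
  have hf2 : ContDiffOn ℝ 0 (deriv (deriv f)) (Set.Ioi 0) :=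
    hf1.deriv_of_isOpen isOpen_Ioi (by norm_num)
  obtain ⟨K₁, hK₁⟩ := isCompact_Icc.exists_bound_of_continuousOn (hf1.continuousOn.mono hsub)
  obtain ⟨K₂, hK₂⟩ := isCompact_Icc.exists_bound_of_continuousOn (hf2.continuousOn.mono hsub)
  have d1 : ∀ τ, 0 < τ → HasDerivAt f (deriv f τ) τ := fun τ hτ =>
    ((hf.differentiableOn (by norm_num)).differentiableAt (Ioi_mem_nhds hτ)).hasDerivAt
  have d2 : ∀ τ, 0 < τ → HasDerivAt (deriv f) (deriv (deriv f) τ) τ := fun τ hτ =>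
    ((hf1.differentiableOn (by norm_num)).differentiableAt (Ioi_mem_nhds hτ)).hasDerivAt
  set K := |K₁| + |K₂| + 1 with hK
  have hK0 : 0 < K := by positivity
  refine ⟨min (2 * a / K) (2 / K), lt_min (by positivity) (by positivity), fun ε h0 hε => ?_⟩
  have hε1 : ε * K ≤ 2 * a := (le_div_iff₀ hK0).1 (hε.trans (min_le_left _ _))
  have hε2 : ε * K ≤ 2 := (le_div_iff₀ hK0).1 (hε.trans (min_le_right _ _))
  have D1 : ∀ τ, 0 < τ → HasDerivAt (fun τ => τ ^ 2 - ε * f τ) (2 * τ - ε * deriv f τ) τ := by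
    intro τ hτ
    simpa using (hasDerivAt_pow 2 τ).fun_sub ((d1 τ hτ).const_mul ε)
  have D2 : ∀ τ, 0 < τ → HasDerivAt (fun τ => 2 * τ - ε * deriv f τ)
      (2 - ε * deriv (deriv f) τ) τ := by
    intro τ hτ
    simpa using ((hasDerivAt_id τ).const_mul 2).fun_sub ((d2 τ hτ).const_mul ε)
  have hc : ContinuousOn (fun τ => τ ^ 2 - ε * f τ) (Set.Icc a b) := fun τ hτ =>
    (D1 τ (hsub hτ)).continuousAt.continuousWithinAt
  constructor
  · refine convexOn_of_hasDerivWithinAt2_nonneg (convex_Icc a b) hc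
      (fun τ hτ => (D1 τ (hsub (interior_subset hτ))).hasDerivWithinAt)
      (fun τ hτ => (D2 τ (hsub (interior_subset hτ))).hasDerivWithinAt) fun τ hτ => ?_
    have h1 := (le_abs_self _).trans (hK₂ τ (interior_subset hτ))
    have h2 : deriv (deriv f) τ ≤ K := by linarith [le_abs_self K₂, abs_nonneg K₁]
    nlinarith
  · refine monotoneOn_of_deriv_nonneg (convex_Icc a b) hc
      (fun τ hτ => (D1 τ (hsub (interior_subset hτ))).differentiableAt.differentiableWithinAt)
      fun τ hτ => ?_
    have hτ' := interior_subset hτ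
    rw [(D1 τ (hsub hτ')).deriv]
    have h1 := (le_abs_self _).trans (hK₁ τ hτ')
    have h2 : deriv f τ ≤ K := by linarith [le_abs_self K₁, abs_nonneg K₂]
    nlinarith [hτ'.1]

/-- Squaring makes the Euclidean part of the inequality `‖x - y‖ < r * m ‖y‖` uniformly convex, so
that it absorbs the term with the factor `r ^ 2`. -/
lemma exists_convex_setOf_norm_sub_lt {m : ℝ → ℝ} (hm : ContDiffOn ℝ 2 m (Set.Ioi 0))
    (hm0 : ∀ τ, 0 ≤ τ → 0 ≤ m τ) {A : ℝ} (hA : ∀ τ, 0 ≤ τ → m τ ≤ A * (1 + τ)) {x : E}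
    (hx : x ≠ 0) :
    ∃ r₀ > 0, ∀ r, 0 < r → r < r₀ → Convex ℝ {y : E | ‖x - y‖ < r * m ‖y‖} := by
  have hx0 : 0 < ‖x‖ := norm_pos_iff.2 hx
  set δ := ‖x‖ / 2 with hδ
  have hδ0 : 0 < δ := half_pos hx0
  have hball : ∀ y ∈ Metric.ball x δ, ‖y‖ ∈ Set.Icc δ (3 * δ) := by
    intro y hy
    rw [mem_ball_iff_norm] at hy
    have h1 := abs_lt.1 ((abs_norm_sub_norm_le y x).trans_lt hy)
    constructor <;> linarith
  obtain ⟨ε₀, hε₀, hk⟩ := exists_convexOn_sq_sub_mul (hm.pow 2) (b := 3 * δ) hδ0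
  set B := |A| + 1 with hB
  have hB0 : 0 < B := by positivity
  have hden : 0 < B * (1 + ‖x‖ + δ) := by positivity
  refine ⟨min (√ε₀) (δ / (B * (1 + ‖x‖ + δ))),
    lt_min (Real.sqrt_pos.2 hε₀) (div_pos hδ0 hden), fun r hr0 hr => ?_⟩
  obtain ⟨hkc, hkm⟩ := hk (r ^ 2) (by positivity)
    ((Real.le_sqrt' hr0).1 (hr.le.trans (min_le_left _ _)))
  have hr2 : r * (B * (1 + ‖x‖ + δ)) < δ :=
    (lt_div_iff₀ hden).1 (hr.trans_le (min_le_right _ _))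
  set k : ℝ → ℝ := fun τ => τ ^ 2 - r ^ 2 * m τ ^ 2 with hkdef
  have hH : ConvexOn ℝ (Metric.ball x δ) (fun y : E => ‖x‖ ^ 2 - 2 * ⟪x, y⟫ + k ‖y‖) := by
    refine ⟨convex_ball x δ, fun y hy z hz a b ha hb hab => ?_⟩
    have hy' := hball y hy
    have hz' := hball z hz
    have h1 := hkc.2 hy' hz' ha hb hab
    have h2 : ‖a • y + b • z‖ ≤ a • ‖y‖ + b • ‖z‖ := by
      refine (norm_add_le _ _).trans_eq ?_
      rw [norm_smul, norm_smul, Real.norm_of_nonneg ha, Real.norm_of_nonneg hb, smul_eq_mul,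
        smul_eq_mul]
    have h3 := hkm (hball _ (convex_ball x δ hy hz ha hb hab))
      (convex_Icc δ (3 * δ) hy' hz' ha hb hab) h2
    have h4 : k ‖a • y + b • z‖ ≤ a * k ‖y‖ + b * k ‖z‖ := h3.trans h1
    have h5 : ‖x‖ ^ 2 = a * ‖x‖ ^ 2 + b * ‖x‖ ^ 2 := by rw [← add_mul, hab, one_mul]
    simp only [inner_add_right, inner_smul_right, smul_eq_mul]
    linarith
  have hset : {y : E | ‖x - y‖ < r * m ‖y‖} =
      {y ∈ Metric.ball x δ | ‖x‖ ^ 2 - 2 * ⟪x, y⟫ + k ‖y‖ < 0} := by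
    ext y
    have hy0 := norm_nonneg y
    have e1 : ‖x‖ ^ 2 - 2 * ⟪x, y⟫ + k ‖y‖ = ‖x - y‖ ^ 2 - (r * m ‖y‖) ^ 2 := by
      simp only [norm_sub_sq_real, hkdef]
      ring
    have e2 : ‖x - y‖ < r * m ‖y‖ ↔ ‖x - y‖ ^ 2 - (r * m ‖y‖) ^ 2 < 0 := by
      rw [sub_neg, sq_lt_sq₀ (norm_nonneg _) (mul_nonneg hr0.le (hm0 _ hy0))]
    simp only [Set.mem_ofPred_eq, e1]
    rw [← e2]
    refine ⟨fun h => ⟨?_, h⟩, fun h => h.2⟩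
    rw [mem_ball_iff_norm, norm_sub_rev]
    by_contra! hge
    have h1 : ‖y‖ ≤ ‖x‖ + ‖x - y‖ := by
      have := norm_sub_le x (x - y)
      rwa [sub_sub_cancel] at this
    have h2 : m ‖y‖ ≤ B * (1 + (‖x‖ + ‖x - y‖)) := by
      have : A * (1 + ‖y‖) ≤ B * (1 + ‖y‖) := by
        gcongr
        linarith [le_abs_self A]
      have : B * (1 + ‖y‖) ≤ B * (1 + (‖x‖ + ‖x - y‖)) := by gcongr
      linarith [hA _ hy0]
    -- `(1 + ‖x‖ + ρ) / ρ` decreases in `ρ`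
    have h3 : δ * (1 + (‖x‖ + ‖x - y‖)) ≤ ‖x - y‖ * (1 + ‖x‖ + δ) := by nlinarith
    have h4 : r * m ‖y‖ ≤ r * (B * (1 + (‖x‖ + ‖x - y‖))) := by gcongr
    have h5 : r * B * (δ * (1 + (‖x‖ + ‖x - y‖))) ≤ r * B * (‖x - y‖ * (1 + ‖x‖ + δ)) := by gcongr
    have h6 : 0 < ‖x - y‖ := hδ0.trans_le hge
    nlinarith
  rw [hset]
  exact hH.convex_lt 0

end Inner

section LocalConvexity

variable {E : Type*} [NormedAddCommGroup E] [InnerProductSpace ℝ E] {p : ℝ≥0∞} {q : ℝ}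

/-- Around the origin the balls are Euclidean balls for `q < 1` and points for `q = 1`. -/
lemma convex_ball_relDist_zero (hp : 0 < p) (hq : 0 ≤ q) (hq1 : q ≤ 1)
    (hd : IsMetric (relDist (pqM p q) : E → E → ℝ)) {r : ℝ} (hr0 : 0 < r) (hr1 : r < 1) :
    Convex ℝ {y : E | relDist (pqM p q) 0 y < r} := by
  rcases hq1.eq_or_lt with rfl | hq1
  · have : {y : E | relDist (pqM p 1) 0 y < r} = {0} := by
      ext y
      rw [Set.mem_ofPred_eq, Set.mem_singleton_iff]
      constructor
      · intro h
        by_contra hy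
        rw [relDist_zero_left hp hy, sub_self, Real.rpow_zero] at h
        linarith
      · rintro rfl
        rwa [hd.self_eq_zero]
    rw [this]
    exact convex_singleton 0
  · have hq' : 0 < 1 - q := by linarith
    have : {y : E | relDist (pqM p q) 0 y < r} = Metric.ball 0 (r ^ (1 - q)⁻¹) := by
      ext y
      rw [Set.mem_ofPred_eq, mem_ball_zero_iff]
      rcases eq_or_ne y 0 with rfl | hy
      · rw [hd.self_eq_zero, norm_zero]
        exact ⟨fun _ => by positivity, fun _ => hr0⟩
      · rw [relDist_zero_left hp hy, Real.lt_rpow_inv_iff_of_pos (norm_nonneg _) hr0.le hq']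
    rw [this]
    exact convex_ball _ _

lemma isLocallyConvex_relDist (hp : 0 < p) (hp' : p ≠ ⊤) (hq : 0 ≤ q) (hq1 : q ≤ 1)
    (hd : IsMetric (relDist (pqM p q) : E → E → ℝ)) :
    IsLocallyConvex (relDist (pqM p q) : E → E → ℝ) := by
  intro x
  rcases eq_or_ne x 0 with rfl | hx
  · exact ⟨1, one_pos, fun r hr0 hr1 => convex_ball_relDist_zero hp hq hq1 hd hr0 hr1⟩
  have hx0 : 0 < ‖x‖ := norm_pos_iff.2 hx
  have hm : ContDiffOn ℝ 2 (fun τ => pqM p q ‖x‖ τ) (Set.Ioi 0) := by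
    simp only [pqM, if_neg hp']
    refine ContDiffOn.rpow_const_of_ne (contDiffOn_const.add
      (contDiffOn_id.rpow_const_of_ne fun τ hτ => ?_)) fun τ hτ => ?_
    · exact (Set.mem_Ioi.1 hτ).ne'
    · have : 0 < τ := hτ
      positivity
  have hA : ∀ τ, 0 ≤ τ → pqM p q ‖x‖ τ ≤ 2 ^ (q * p⁻¹.toReal) * (1 + ‖x‖) * (1 + τ) := by
    intro τ hτ
    have h1 := pqM_mono (p := p) hq hx0.le hτ (by linarith : ‖x‖ ≤ 1 + ‖x‖ + τ)
      (by linarith : τ ≤ 1 + ‖x‖ + τ)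
    rw [pqM_self hp (by positivity)] at h1
    have h2 : (1 + ‖x‖ + τ) ^ q ≤ 1 + ‖x‖ + τ := Real.rpow_le_self_of_one_le (by linarith) hq1
    have h3 : 1 + ‖x‖ + τ ≤ (1 + ‖x‖) * (1 + τ) := by nlinarith
    rw [mul_assoc]
    refine h1.trans ?_
    gcongr
    exact h2.trans h3
  obtain ⟨r₀, hr₀, h⟩ := exists_convex_setOf_norm_sub_lt hm
    (fun τ hτ => pqM_nonneg hx0.le hτ) hA hx
  refine ⟨r₀, hr₀, fun r hr0 hr => ?_⟩
  convert h r hr0 hr using 3 with y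
  rw [relDist, div_lt_iff₀]
  rw [pqM_comm]
  exact pqM_pos hp hq (norm_nonneg _) hx0

/-! ### Small balls for `p = ∞` -/

/-- The sphere `‖y‖ = ‖x‖` makes a reentrant corner in the boundary of each small ball around a unit
vector `x`: a line through a point of that corner, close to the tangent of the Euclidean sphere
around `x`, enters the ball on both sides. -/
lemma not_isLocallyConvex_relDist_top (hE : 2 ≤ Module.finrank ℝ E) (hq0 : 0 < q) (hq1 : q ≤ 1) :
    ¬ IsLocallyConvex (relDist (pqM ⊤ q) : E → E → ℝ) := by
  intro hloc
  obtain ⟨u, hu⟩ := exists_norm_eq_one (E := E) (by omega)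
  obtain ⟨v, hv, huv⟩ := exists_norm_eq_one_inner_eq_zero hE u
  obtain ⟨r₀, hr₀, hconv⟩ := hloc u
  set r := min (r₀ / 2) 1 with hr
  have hr0 : 0 < r := lt_min (by linarith) one_pos
  have hr1 : r ≤ 1 := min_le_right _ _
  have hC := hconv r hr0 ((min_le_left _ _).trans_lt (by linarith))
  have hmem : ∀ y : E, y ∈ {y | relDist (pqM ⊤ q) u y < r} ↔ ‖u - y‖ < r * max 1 ‖y‖ ^ q := by
    intro y
    rw [Set.mem_ofPred_eq, relDist, pqM, if_pos rfl, hu, div_lt_iff₀ (by positivity)]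
  have hnorm : ∀ a b : ℝ, ‖a • u + b • v‖ ^ 2 = a ^ 2 + b ^ 2 := norm_sq_smul_add_smul hu hv huv
  have hsub : ∀ a b : ℝ, ‖u - (a • u + b • v)‖ ^ 2 = (1 - a) ^ 2 + b ^ 2 := by
    intro a b
    have : u - (a • u + b • v) = (1 - a) • u + (-b) • v := by module
    rw [this, hnorm, neg_sq]
  -- the point `c • u + σ • v` of the corner
  set c := 1 - r ^ 2 / 2 with hc
  have hc0 : 0 < c := by nlinarith
  have hc1 : c < 1 := by nlinarith
  set σ := √(1 - c ^ 2) with hσ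
  have hσ2 : σ ^ 2 = 1 - c ^ 2 := Real.sq_sqrt (by nlinarith)
  have hσ0 : 0 < σ := Real.sqrt_pos.2 (by nlinarith)
  -- `1 + z * β` is the chord of `(1 + z) ^ q` over `[0, 1]`
  set β := (2 : ℝ) ^ q - 1 with hβ
  have hβ0 : 0 < β := sub_pos.2 (Real.one_lt_rpow (by norm_num) hq0)
  have hchord : ∀ z : ℝ, 0 ≤ z → z ≤ 1 → 1 + z * β ≤ (1 + z) ^ q := by
    intro z h0 h1
    have h := (Real.concaveOn_rpow hq0.le hq1).2 (x := 1) (y := 2)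
      (Set.mem_Ici.2 zero_le_one) (Set.mem_Ici.2 zero_le_two) (sub_nonneg.2 h1) h0 (by ring)
    simp only [smul_eq_mul, Real.one_rpow] at h
    have e : (1 - z) * 1 + z * 2 = 1 + z := by ring
    rw [e] at h
    rw [hβ]
    linarith
  -- the direction `(ω₁, ω₂)` increases the norm at unit rate and `‖u - ·‖ ^ 2` at rate `2 * η`
  set η := β * r ^ 2 / 2 with hη
  have hη0 : 0 < η := by positivity
  set ω₁ := 1 - η with hω₁
  set ω₂ := (1 - c * ω₁) / σ with hω₂
  have hω : c * ω₁ + σ * ω₂ = 1 := by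
    rw [hω₂]
    field_simp
    ring
  set W := ω₁ ^ 2 + ω₂ ^ 2 with hW
  have hW0 : 0 ≤ W := by positivity
  set t := min (1 / 2) (η / (W + 1)) with ht
  have ht0 : 0 < t := lt_min (by norm_num) (by positivity)
  have ht1 : 2 * t ≤ 1 := by linarith [min_le_left (1 / 2) (η / (W + 1))]
  have htW : t * W < 2 * η := by
    have : t * (W + 1) ≤ η := (le_div_iff₀ (by positivity)).1 (min_le_right _ _)
    nlinarith
  have hminus : (c - t * ω₁) • u + (σ - t * ω₂) • v ∈ {y | relDist (pqM ⊤ q) u y < r} := by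
    rw [hmem]
    have h1 : ‖u - ((c - t * ω₁) • u + (σ - t * ω₂) • v)‖ < r := by
      rw [← sq_lt_sq₀ (norm_nonneg _) hr0.le, hsub]
      have e : (1 - (c - t * ω₁)) ^ 2 + (σ - t * ω₂) ^ 2 = r ^ 2 - t * (2 * η - t * W) := by
        linear_combination hσ2 - 2 * t * hω
      rw [e]
      nlinarith [mul_pos ht0 (sub_pos.2 htW)]
    refine h1.trans_le (le_mul_of_one_le_right hr0.le ?_)
    exact Real.one_le_rpow (le_max_left _ _) hq0.le
  have hplus : (c + t * ω₁) • u + (σ + t * ω₂) • v ∈ {y | relDist (pqM ⊤ q) u y < r} := by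
    rw [hmem]
    set y := (c + t * ω₁) • u + (σ + t * ω₂) • v with hy
    have hy2 : ‖y‖ ^ 2 = 1 + 2 * t + t ^ 2 * W := by
      rw [hy, hnorm]
      linear_combination hσ2 + 2 * t * hω
    have h1 : 1 + 2 * t * β ≤ (max 1 ‖y‖ ^ q) ^ 2 := by
      have e : (max 1 ‖y‖ ^ q) ^ 2 = (max 1 ‖y‖ ^ 2) ^ q := by
        rw [← Real.rpow_natCast, ← Real.rpow_natCast, ← Real.rpow_mul (by positivity),
          ← Real.rpow_mul (by positivity), mul_comm]
      rw [e]
      refine (hchord (2 * t) (by linarith) ht1).trans ?_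
      gcongr
      calc 1 + 2 * t ≤ ‖y‖ ^ 2 := by rw [hy2]; nlinarith [mul_nonneg (sq_nonneg t) hW0]
        _ ≤ max 1 ‖y‖ ^ 2 := by gcongr; exact le_max_right _ _
    rw [← sq_lt_sq₀ (norm_nonneg _) (by positivity), mul_pow]
    have e : ‖u - y‖ ^ 2 = r ^ 2 + t * (2 * η + t * W) := by
      rw [hy, hsub]
      linear_combination hσ2 + 2 * t * hω
    have h2 : r ^ 2 * (1 + 2 * t * β) = r ^ 2 + t * (4 * η) := by
      rw [hη]
      ring
    have h3 : r ^ 2 * (1 + 2 * t * β) ≤ r ^ 2 * (max 1 ‖y‖ ^ q) ^ 2 := by gcongr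
    have h4 : t * (2 * η + t * W) < t * (4 * η) := by gcongr; linarith
    linarith
  have hmid := hC hminus hplus (by norm_num : (0 : ℝ) ≤ 1 / 2) (by norm_num : (0 : ℝ) ≤ 1 / 2)
    (by norm_num)
  have e : (1 / 2 : ℝ) • ((c - t * ω₁) • u + (σ - t * ω₂) • v) +
      (1 / 2 : ℝ) • ((c + t * ω₁) • u + (σ + t * ω₂) • v) = c • u + σ • v := by module
  rw [e, hmem] at hmid
  have h1 : ‖c • u + σ • v‖ = 1 := by
    rw [← sq_eq_sq₀ (norm_nonneg _) zero_le_one, hnorm, hσ2]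
    ring
  have h2 : ‖u - (c • u + σ • v)‖ = r := by
    rw [← sq_eq_sq₀ (norm_nonneg _) hr0.le, hsub, hσ2, hc]
    ring
  rw [h1, h2, max_self, Real.one_rpow, mul_one] at hmid
  exact lt_irrefl _ hmid

end LocalConvexity

/-! ### The smallest constant of quasiconvexity -/

lemma le_of_isQuasiconvexWith_relDist {E : Type*} [NormedAddCommGroup E] {p : ℝ≥0∞} {q c : ℝ}
    (hp : 0 < p) (hq : 0 ≤ q) (hq1 : q < 1)
    (hd : IsMetric (relDist (pqM p q) : E → E → ℝ)) {e : E} (he : ‖e‖ = 1)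
    (h : IsQuasiconvexWith (relDist (pqM p q) : E → E → ℝ) c) :
    2 ^ (-(q * p⁻¹.toReal)) / (1 - q) ≤ c := by
  have he0 : e ≠ 0 := by rintro rfl; simp at he
  have h1 := (le_innerDist_zero hp hq hq1 hd e).trans (h 0 e)
  rw [relDist_zero_left hp he0, he, Real.one_rpow, mul_one, mul_one] at h1
  have h2 : 0 < (2 : ℝ) ^ (-(q * p⁻¹.toReal)) / (1 - q) :=
    div_pos (by positivity) (by linarith)
  by_contra! hlt
  exact absurd h1 (not_le.2 ((ENNReal.ofReal_lt_ofReal_iff h2).2 hlt))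

theorem theorem1p2 (p : ℝ≥0∞) (hp : 0 < p) (q : ℝ) (hq : 0 ≤ q) :
    ((∀ n : ℕ, 2 ≤ n → IsMetric (pqDist p q n) → (IsQuasiconvex (pqDist p q n) ↔ q < 1)) ∧
      (q < 1 → ∃ c : ℝ,
        (2 : ℝ) ^ (-(q * p⁻¹.toReal)) / (1 - q) ≤ c ∧
        c ≤ max ((2 : ℝ) ^ (q * (1 - p⁻¹.toReal))) 1 / (1 - q) ∧
        ∀ n : ℕ, 2 ≤ n → IsMetric (pqDist p q n) →
          IsLeast {c' : ℝ | IsQuasiconvexWith (pqDist p q n) c'} c)) ∧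
    ((∀ n : ℕ, 2 ≤ n → IsMetric (pqDist p q n) → 0 < q →
        (IsLocallyConvex (pqDist p q n) ↔ p < ⊤)) ∧
      (∀ n : ℕ, 1 ≤ n → IsMetric (pqDist p q n) → p < ⊤ → IsLocallyConvex (pqDist p q n))) := by
  have hrel : ∀ n, pqDist p q n = relDist (pqM p q) := fun n => rfl
  have hunit : ∀ n : ℕ, 1 ≤ n → ∃ e : EuclideanSpace ℝ (Fin n), ‖e‖ = 1 := fun n hn =>
    exists_norm_eq_one (by simpa using hn)
  have hle : ∀ n : ℕ, 1 ≤ n → IsMetric (pqDist p q n) → q ≤ 1 := fun n hn hd => by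
    obtain ⟨e, he⟩ := hunit n hn
    exact le_one_of_isMetric hp hd he
  have hupper : ∀ n : ℕ, 1 ≤ n → q < 1 → IsMetric (pqDist p q n) →
      IsQuasiconvexWith (pqDist p q n) (max ((2 : ℝ) ^ (q * (1 - p⁻¹.toReal))) 1 / (1 - q)) :=
    fun n hn hq1 hd => by
      obtain ⟨e, he⟩ := hunit n hn
      exact isQuasiconvexWith_relDist hp hq hq1 hd (isMetric_real hd he)
  have hloc : ∀ n : ℕ, 1 ≤ n → IsMetric (pqDist p q n) → p < ⊤ →
      IsLocallyConvex (pqDist p q n) := fun n hn hd hp' =>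
    isLocallyConvex_relDist hp hp'.ne hq (hle n hn hd) hd
  refine ⟨⟨fun n hn hd => ⟨?_, fun hq1 => ⟨_, hupper n (by omega) hq1 hd⟩⟩, fun hq1 => ?_⟩,
    fun n hn hd hq0 => ⟨?_, hloc n (by omega) hd⟩, hloc⟩
  · rintro ⟨c, hc⟩
    refine lt_of_le_of_ne (hle n (by omega) hd) ?_
    rintro rfl
    obtain ⟨e, he⟩ := hunit n (by omega)
    have he0 : e ≠ 0 := by rintro rfl; simp at he
    have h := hc 0 e
    rw [hrel] at hd h
    rw [innerDist_zero_eq_top_of_eq_one hp hd he0] at h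
    exact ENNReal.ofReal_ne_top (top_le_iff.1 h)
  · by_cases hex : ∃ m : ℕ, 2 ≤ m ∧ IsMetric (pqDist p q m)
    · obtain ⟨m, hm, hdm⟩ := hex
      have hlower : ∀ c ∈ {c' : ℝ | IsQuasiconvexWith (pqDist p q m) c'},
          (2 : ℝ) ^ (-(q * p⁻¹.toReal)) / (1 - q) ≤ c := fun c hc => by
        obtain ⟨e, he⟩ := hunit m (by omega)
        exact le_of_isQuasiconvexWith_relDist hp hq hq1 hdm he hc
      have hup := hupper m (by omega) hq1 hdm
      have hbdd : BddBelow {c' : ℝ | IsQuasiconvexWith (pqDist p q m) c'} := ⟨_, hlower⟩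
      have hmem := (isClosed_setOf_isQuasiconvexWith (pqDist p q m)).csInf_mem ⟨_, hup⟩ hbdd
      refine ⟨sInf {c' : ℝ | IsQuasiconvexWith (pqDist p q m) c'}, hlower _ hmem,
        csInf_le hbdd hup, fun n hn hd => ?_⟩
      have heq : {c' : ℝ | IsQuasiconvexWith (pqDist p q n) c'} =
          {c' : ℝ | IsQuasiconvexWith (pqDist p q m) c'} := by
        ext c
        exact ⟨fun h => h.of_finrank (by simpa using hn) (by simpa using hm) hd hdm,
          fun h => h.of_finrank (by simpa using hm) (by simpa using hn) hdm hd⟩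
      rw [heq]
      exact ⟨hmem, fun c hc => csInf_le hbdd hc⟩
    · -- no dimension carries the metric, and only the order of the two bounds matters
      refine ⟨(2 : ℝ) ^ (-(q * p⁻¹.toReal)) / (1 - q), le_rfl, ?_,
        fun n hn hd => absurd ⟨n, hn, hd⟩ hex⟩
      have h1 : (2 : ℝ) ^ (-(q * p⁻¹.toReal)) ≤ 1 :=
        Real.rpow_le_one_of_one_le_of_nonpos (by norm_num)
          (neg_nonpos.2 (mul_nonneg hq ENNReal.toReal_nonneg))
      have : 0 ≤ 1 - q := by linarith
      gcongr
      exact h1.trans (le_max_right _ _)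
  · intro h
    rw [lt_top_iff_ne_top]
    rintro rfl
    exact not_isLocallyConvex_relDist_top (by simpa using hn) hq0 (hle n (by omega) hd) h
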